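/- Let $E$ be a set and let $\lambda:2^E\to\mathbb{N}\cup\{\infty\}$ satisfy $\lambda(A)=\lambda(E\setminus A)$ and $\lambda(A)+\lambda(B)\ge\lambda(A\cup B)+\lambda(A\cap B)$ for all $A,B\subseteq E$. Suppose $\lambda$ is limit-closed: for every $n\in\mathbb{N}$, the union of a non-empty chain of sets $A$ with $\lambda(A)\le n$ is again a set with $\lambda\le n$. Let $k\ge 1$ be an integer. *Profiles.* For $l\in\mathbb{N}$ let $S_l=\{A\subseteq E:\lambda(A)<l\}$. A *$k$-profile* is a set $P\subseteq S_k$ that contains exactly one of $A$ and $E\setminus A$ for every $A\in S_k$, that is consistent (if $A\subsetneq B$, $E\setminus A\in P$ and $B\in P$, then $B=E\setminus A$), and that satisfies $E\setminus(A\cup B)\notin P$ for all $A,B\in P$. Its truncation to a $(k-1)$-profile is $P\cap S_{k-1}$. A set $A$ *distinguishes* two profiles if one of them contains $A$ and the other contains $E\setminus A$. *Pseudoflowers.* A set $J$ of elements of a cyclically ordered set $I$ is an *interval* if for all $x,y\in J$ at least one of the open arcs $]x,y[$ and $]y,x[$ is contained in $J$ (so the ends of an interval may be cuts of $I$); it is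 *non-trivial* if $\emptyset\ne J\ne I$. A *$k$-pseudoflower* is a partition $\Phi=(P_i)_{i\in I}$ of $E$ into non-empty sets, the *petals*, with a cyclically ordered index set $I$, such that $\lambda(\bigcup_{i\in J}P_i)\le k-1$ for every interval $J$ of $I$. The sets $\bigcup_{i\in J}P_i$ with $J$ a non-trivial interval are *displayed* by $\Phi$. A $k$-pseudoflower $\Phi=(Q_j)_{j\in I'}$ is a *concatenation* of a $k$-pseudoflower $\Psi=(P_i)_{i\in I}$, written $\Phi\le\Psi$, if there is a map $f:I\to I'$ such that $P_i\subseteq Q_{f(i)}$ for all $i\in I$ and such that $f^{-1}(J)$ is an interval of $I$ for every interval $J$ of $I'$. A $k$-pseudoflower is a *$k$-daisy* if it has at least four petals, every set displayed by it has $\lambda$-value exactly $k-1$, and in each of its concatenations $(Q_j)_{j\in I'}$ with finitely many petals, for every $J$ with $\emptyset\ne J\subsetneq I'$, we have $\lambda(\bigcup_{j\in J}Q_j)=k-1$ if and only if $J$ is an interval of $I'$. *Comparison by profiles.* Let $\mathcal{P}$ be a set of $k$-profiles that all have the same truncation to a $(k-1)$-profile. For $k$-pseudoflowers $\Phi$ and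 $\Psi$ let $\Phi\preccurlyeq\Psi$ if any two elements of $\mathcal{P}$ that are distinguished by the union of the petals of an interval of $\Phi$ are also distinguished by the union of the petals of an interval of $\Psi$. An element $\Phi$ is maximal in a pre-order if every element above $\Phi$ is also below $\Phi$. **Statement.** Let $\Phi$ be a $\le$-maximal $k$-pseudoflower which has a concatenation that is a $k$-daisy, and suppose that there are at least three elements of $\mathcal{P}$ that are pairwise distinguished by sets displayed by $\Phi$. Then $\Phi$ is $\preccurlyeq$-maximal: for every $k$-pseudoflower $\Psi$ with $\Phi\preccurlyeq\Psi$ also $\Psi\preccurlyeq\Phi$. -/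

import Mathlib

universe u

/-- A set of elements of a cyclically ordered type is an interval if any two of its elements are
joined by one of the two open arcs between them inside the set. This covers `∅`, the whole type,
singletons, and intervals whose ends are cuts rather than elements. -/
def IsCyclicInterval {I : Type u} [CircularOrder I] (J : Set I) : Prop :=
  ∀ x ∈ J, ∀ y ∈ J, Set.cIoo x y ⊆ J ∨ Set.cIoo y x ⊆ J

/-- A limit-closed connectivity system on the ground set `E`. -/
structure ConnectivitySystem (E : Type u) where
  conn : Set E → ℕ∞
  conn_compl : ∀ A : Set E, conn Aᶜ = conn A
  submodular : ∀ A B : Set E, conn (A ∪ B) + conn (A ∩ B) ≤ conn A + conn B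
  limitClosed : ∀ (n : ℕ) (C : Set (Set E)), C.Nonempty → IsChain (· ⊆ ·) C →
    (∀ A ∈ C, conn A ≤ n) → conn (⋃₀ C) ≤ n

namespace ConnectivitySystem

variable {E : Type u}

/-- A `k`-profile: a consistent orientation, with the profile property, of the system of all
sets of connectivity less than `k`. The inverse of a set is its complement, and the join of two
sets is their union. -/
structure IsProfile (M : ConnectivitySystem E) (k : ℕ) (P : Set (Set E)) : Prop where
  conn_lt : ∀ A ∈ P, M.conn A < k
  orientation : ∀ A : Set E, M.conn A < k → ∃! B : Set E, B ∈ P ∧ (B = A ∨ B = Aᶜ)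
  consistent : ∀ A B : Set E, Aᶜ ∈ P → B ∈ P → A ⊂ B → B = Aᶜ
  profile : ∀ A ∈ P, ∀ B ∈ P, (A ∪ B)ᶜ ∉ P

/-- The truncation of a profile to an `l`-profile. -/
def truncation (M : ConnectivitySystem E) (l : ℕ) (P : Set (Set E)) : Set (Set E) :=
  {A ∈ P | M.conn A < l}

/-- A `k`-pseudoflower: a partition of `E` into nonempty petals with a cyclically ordered index
type such that the union of every interval of petals has connectivity at most `k - 1`. As the
petals are nonempty and disjoint, the index type embeds into `E`, so that it is no restriction to
take it from the universe of `E`. -/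
structure PseudoFlower (M : ConnectivitySystem E) (k : ℕ) where
  Index : Type u
  [order : CircularOrder Index]
  petal : Index → Set E
  petal_nonempty : ∀ i, (petal i).Nonempty
  petal_disjoint : ∀ i j, i ≠ j → Disjoint (petal i) (petal j)
  petal_cover : ⋃ i, petal i = Set.univ
  conn_lt : ∀ J : Set Index, IsCyclicInterval J → M.conn (⋃ i ∈ J, petal i) < k

attribute [instance] PseudoFlower.order

namespace PseudoFlower

variable {M : ConnectivitySystem E} {k : ℕ}

/-- The union of the petals with index in `J`. -/
def unionOf (Φ : M.PseudoFlower k) (J : Set Φ.Index) : Set E :=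
  ⋃ i ∈ J, Φ.petal i

/-- `A` is displayed by `Φ`: it is the union of a non-trivial interval of petals. -/
def Displays (Φ : M.PseudoFlower k) (A : Set E) : Prop :=
  ∃ J : Set Φ.Index, IsCyclicInterval J ∧ J.Nonempty ∧ J ≠ Set.univ ∧ Φ.unionOf J = A

/-- `Φ` is a concatenation of `Ψ` (and `Ψ` is an extension of `Φ`). -/
def IsConcatenation (Φ Ψ : M.PseudoFlower k) : Prop :=
  ∃ f : Ψ.Index → Φ.Index, (∀ i, Ψ.petal i ⊆ Φ.petal (f i)) ∧
    ∀ J : Set Φ.Index, IsCyclicInterval J → IsCyclicInterval (f ⁻¹' J)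

/-- `Φ ≤ Ψ` if and only if `Φ` is a concatenation of `Ψ`. -/
instance : Preorder (M.PseudoFlower k) where
  le := IsConcatenation
  le_refl Φ := ⟨id, fun _ => subset_rfl, fun _ h => h⟩
  le_trans := by
    rintro Φ Ψ Θ ⟨f, hf, hf'⟩ ⟨g, hg, hg'⟩
    exact ⟨f ∘ g, fun i => (hg i).trans (hf (g i)), fun J hJ => hg' _ (hf' J hJ)⟩

/-- A `k`-flower: at least four petals, and the union of every non-trivial interval of petals has
connectivity exactly `k - 1`. -/
def IsFlower (Φ : M.PseudoFlower k) : Prop :=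
  4 ≤ ENat.card Φ.Index ∧ ∀ A : Set E, Φ.Displays A → M.conn A + 1 = k

/-- A `k`-daisy: a `k`-flower such that in every finite concatenation the non-trivial unions of
petals of connectivity `k - 1` are exactly those whose indices form an interval. -/
def IsDaisy (Φ : M.PseudoFlower k) : Prop :=
  Φ.IsFlower ∧ ∀ Ψ : M.PseudoFlower k, Ψ ≤ Φ → Finite Ψ.Index →
    ∀ J : Set Ψ.Index, J.Nonempty → J ≠ Set.univ →
      (M.conn (Ψ.unionOf J) + 1 = k ↔ IsCyclicInterval J)

end PseudoFlower

/-- The set `A` distinguishes the profiles `P` and `Q`: they contain distinct orientations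
of `A`. -/
def Distinguishes (A : Set E) (P Q : Set (Set E)) : Prop :=
  (A ∈ P ∧ Aᶜ ∈ Q) ∨ (Aᶜ ∈ P ∧ A ∈ Q)

namespace PseudoFlower

variable {M : ConnectivitySystem E} {k : ℕ}

/-- Some set displayed by `Φ` distinguishes `P` and `Q`. -/
def DisplaysDistinction (Φ : M.PseudoFlower k) (P Q : Set (Set E)) : Prop :=
  ∃ A : Set E, Φ.Displays A ∧ Distinguishes A P Q

/-- At least three elements of `Pset` are pairwise distinguished by sets displayed by `Φ`. -/
def DistinguishesThree (Φ : M.PseudoFlower k) (Pset : Set (Set (Set E))) : Prop :=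
  ∃ P ∈ Pset, ∃ Q ∈ Pset, ∃ R ∈ Pset,
    Φ.DisplaysDistinction P Q ∧ Φ.DisplaysDistinction P R ∧ Φ.DisplaysDistinction Q R

/-- The pre-order `Φ ≼ Ψ` with respect to `Pset`: any two elements of `Pset` that are distinguished by
the union of an interval of `Φ` are distinguished by the union of an interval of `Ψ`. -/
def Prec (Pset : Set (Set (Set E))) (Φ Ψ : M.PseudoFlower k) : Prop :=
  ∀ P ∈ Pset, ∀ Q ∈ Pset,
    (∃ J : Set Φ.Index, IsCyclicInterval J ∧ Distinguishes (Φ.unionOf J) P Q) →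
    ∃ J : Set Ψ.Index, IsCyclicInterval J ∧ Distinguishes (Ψ.unionOf J) P Q

/-- Maximality in the pre-order `≼` among all `k`-pseudoflowers. -/
def IsPrecMaximal (Pset : Set (Set (Set E))) (Φ : M.PseudoFlower k) : Prop :=
  ∀ Ψ : M.PseudoFlower k, Prec Pset Φ Ψ → Prec Pset Ψ Φ

end PseudoFlower

end ConnectivitySystem

/-!
A profile `P` lives in `A` if `Aᶜ ∈ P`. Suppose that some `k`-pseudoflower `Ψ` above `Φ` in `≼`
distinguishes `P` from `Q` and `Φ` does not. As `Φ` distinguishes three profiles, it distinguishes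
`P` from some `q` and `r` as well as `q` from `r`. Uncrossing two interval unions of `Ψ` yields one
set `Y` that distinguishes both `P` from `Q` and `q` from `r`. There are two cases.

If `P` lives in a petal of `Φ`, then so does `Q`, and uncrossing `Y` with the interval unions of
`Φ` shows that `Y` divides this petal into two petals of a larger pseudoflower. This contradicts
`≤`-maximality.

Otherwise `P` and `Q` live at a cut of the cyclic order of `Φ`. Cut the cyclic order open there, so
that all proper initial unions are members of `P` and `Q`. Limit-closedness makes `Y` cross a
bounded piece of the order close to its end, and uncrossing then shows that two non-adjacent
intervals, one of them at the end, have a union of connectivity at most `k - 1`. In a concatenation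
of a daisy to four petals, one of two opposite petals contains the end of the order, and the same
bound for their union contradicts the definition of a daisy.
-/

/-! ### Intervals of cyclic orders -/

section CyclicOrder

variable {I : Type u} [CircularOrder I] {r : LinearOrder I} {J : Set I}

/-- The linear order `r` arises by cutting the cyclic order on `I` open: going up in `r` means
going round in the cyclic order. -/
def IsCutOpen (r : LinearOrder I) : Prop :=
  ∀ x y z : I, r.lt x y → r.lt y z → sbtw x y z

theorem isCutOpen_toCircularOrder {L : Type u} (r : LinearOrder L) :
    @IsCutOpen L (LinearOrder.toCircularOrder L) r :=
  fun _ _ _ hxy hyz => Or.inl ⟨hxy, hyz⟩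

theorem IsCutOpen.sbtw_iff_of_lt (hr : IsCutOpen r) {x y z : I} (h : x < y) :
    sbtw x z y ↔ x < z ∧ z < y := by
  refine ⟨fun hz => ?_, fun hz => hr x z y hz.1 hz.2⟩
  have hzx : z ≠ x := by rintro rfl; exact sbtw_irrefl_left hz
  have hzy : z ≠ y := by rintro rfl; exact sbtw_irrefl_right hz
  refine ⟨hzx.lt_or_gt.resolve_left fun hlt => ?_, hzy.lt_or_gt.resolve_right fun hlt => ?_⟩
  · exact hz.not_sbtw (hr z x y hlt h).cyclic_right
  · exact hz.not_sbtw (hr x y z h hlt).cyclic_left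

theorem IsCutOpen.sbtw_iff_of_gt (hr : IsCutOpen r) {x y z : I} (h : x < y) :
    sbtw y z x ↔ z < x ∨ y < z := by
  refine ⟨fun hz => ?_, ?_⟩
  · by_contra! hcon
    have hxz : x ≠ z := by rintro rfl; exact sbtw_irrefl_right hz
    have hzy : z ≠ y := by rintro rfl; exact sbtw_irrefl_left hz
    exact hz.not_sbtw (hr x z y (hxz.lt_of_le hcon.1) (hzy.lt_of_le hcon.2))
  · rintro (hz | hz)
    · exact (hr z x y hz h).cyclic_right
    · exact (hr x y z h hz).cyclic_left

theorem IsCutOpen.isCyclicInterval_of_ordConnected (hr : IsCutOpen r) (hJ : J.OrdConnected) :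
    IsCyclicInterval J := by
  intro x hx y hy
  wlog hxy : x ≤ y generalizing x y
  · exact (this y hy x hx (le_of_not_ge hxy)).symm
  obtain rfl | hlt := hxy.eq_or_lt
  · exact Or.inl fun z hz => (sbtw_irrefl_left_right hz).elim
  · refine Or.inl fun z hz => hJ.out hx hy ?_
    exact ((hr.sbtw_iff_of_lt hlt).1 hz).imp le_of_lt le_of_lt

theorem IsCyclicInterval.compl (hJ : IsCyclicInterval J) : IsCyclicInterval Jᶜ := by
  intro x hx y hy
  by_contra! hcon
  obtain ⟨⟨z, hz, hzJ⟩, w, hw, hwJ⟩ := hcon.imp Set.not_subset.1 Set.not_subset.1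
  rw [Set.mem_compl_iff, not_not] at hzJ hwJ
  rcases hJ z hzJ w hwJ with h | h
  · exact hy (h (hw.trans_right hz.cyclic_right).cyclic_right)
  · exact hx (h (hz.trans_right hw.cyclic_right).cyclic_right)

theorem IsCutOpen.isCyclicInterval_iff (hr : IsCutOpen r) :
    IsCyclicInterval J ↔ J.OrdConnected ∨ Jᶜ.OrdConnected := by
  constructor
  · refine fun hJ => or_iff_not_imp_left.2 fun hcon => ⟨fun a ha c hc b hb hbJ => ?_⟩
    simp only [Set.ordConnected_iff, not_forall, Set.not_subset] at hcon
    obtain ⟨x, hx, z, hz, -, y, ⟨hxy, hyz⟩, hyJ⟩ := hcon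
    replace hxy : x < y := hxy.lt_of_ne (ne_of_mem_of_not_mem hx hyJ)
    replace hyz : y < z := hyz.lt_of_ne (ne_of_mem_of_not_mem hz hyJ).symm
    have houter : Set.cIoo z x ⊆ J := (hJ x hx z hz).resolve_left fun h =>
      hyJ (h ((hr.sbtw_iff_of_lt (hxy.trans hyz)).2 ⟨hxy, hyz⟩))
    have hxa : x < a := (ne_of_mem_of_not_mem hx ha).lt_of_le <| not_lt.1 fun h =>
      ha (houter ((hr.sbtw_iff_of_gt (hxy.trans hyz)).2 (Or.inl h)))
    have hab : a < b := hb.1.lt_of_ne (ne_of_mem_of_not_mem hbJ ha).symm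
    have hbc : b < c := hb.2.lt_of_ne (ne_of_mem_of_not_mem hbJ hc)
    have hxb : x < b := hxa.trans hab
    rcases hJ x hx b hbJ with h | h
    · exact ha (h ((hr.sbtw_iff_of_lt hxb).2 ⟨hxa, hab⟩))
    · exact hc (h ((hr.sbtw_iff_of_gt hxb).2 (Or.inr hbc)))
  · rintro (hJ | hJ)
    · exact hr.isCyclicInterval_of_ordConnected hJ
    · simpa only [compl_compl] using (hr.isCyclicInterval_of_ordConnected hJ).compl

theorem isCyclicInterval_singleton (i : I) : IsCyclicInterval {i} := by
  rintro x rfl y rfl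
  exact Or.inl fun z hz => (sbtw_irrefl_left_right hz).elim

theorem sbtw_trichotomy (x y z : I) :
    sbtw x y z ∨ sbtw z y x ∨ x = y ∨ y = z ∨ z = x := by
  by_cases hxyz : btw x y z
  · by_cases hzyx : btw z y x
    · exact Or.inr (Or.inr (hxyz.antisymm hzyx))
    · exact Or.inl (hxyz.sbtw_of_not_btw hzyx)
  · exact Or.inr (Or.inl (sbtw_iff_not_btw.2 hxyz))

theorem exists_isCutOpen_le (i₀ : I) : ∃ r : LinearOrder I, IsCutOpen r ∧ ∀ i, r.le i₀ i := by
  classical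
  let lt (x y : I) : Prop := sbtw i₀ x y ∨ x = i₀ ∧ y ≠ i₀
  have isStrictTotalOrder : IsStrictTotalOrder I lt :=
    { irrefl := by
        rintro x (h | ⟨rfl, h⟩)
        · exact sbtw_irrefl_right h
        · exact h rfl
      trans := by
        rintro x y z (hxy | ⟨rfl, hy⟩) (hyz | ⟨rfl, -⟩)
        · exact Or.inl (hxy.trans_right hyz)
        · exact absurd hxy sbtw_irrefl_left_right
        · exact Or.inr ⟨rfl, fun hz => sbtw_irrefl_left_right (hz ▸ hyz)⟩
        · exact absurd rfl hy
      trichotomous := by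
        intro x y hxy hyx
        simp only [lt, not_or, not_and, not_not] at hxy hyx
        rcases sbtw_trichotomy i₀ x y with h | h | h | h | h
        · exact absurd h hxy.1
        · exact absurd h.cyclic_right hyx.1
        · exact h.symm.trans (hxy.2 h.symm).symm
        · exact h
        · exact (hyx.2 h).trans h.symm }
  refine ⟨linearOrderOfSTO lt, ?_, fun i => ?_⟩
  · rintro x y z (hxy | ⟨rfl, hy⟩) (hyz | ⟨rfl, -⟩)
    · exact (hyz.cyclic_right.trans_left hxy).cyclic_left
    · exact absurd hxy sbtw_irrefl_left_right
    · exact hyz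
    · exact absurd rfl hy
  · exact (eq_or_ne i₀ i).imp_right fun h => Or.inr ⟨rfl, h.symm⟩

variable (I) in
theorem exists_isCutOpen : ∃ r : LinearOrder I, IsCutOpen r := by
  rcases isEmpty_or_nonempty I with h | ⟨⟨i₀⟩⟩
  · exact ⟨LinearOrder.lift' (fun i => (h.elim i : ℕ)) fun i => h.elim i, fun i => h.elim i⟩
  · exact (exists_isCutOpen_le i₀).imp fun _ => And.left

end CyclicOrder

theorem exists_monotone_surjective_fin {I : Type u} [LinearOrder I] {n : ℕ} [NeZero n]
    (hn : n ≤ ENat.card I) : ∃ c : I → Fin n, Monotone c ∧ Function.Surjective c := by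
  obtain ⟨s, -, hs⟩ := Set.exists_subset_encard_eq (Set.encard_univ I ▸ hn)
  lift s to Finset I using Set.finite_of_encard_eq_coe hs
  let e := s.orderEmbOfFin (by simpa using hs)
  refine ⟨fun x => sSup {j | e j ≤ x}, fun x y hxy => sSup_le_sSup fun j hj => le_trans hj hxy,
    fun i => ⟨e i, ?_⟩⟩
  simp only [e.le_iff_le]
  exact isLUB_Iic.sSup_eq

theorem ordConnected_or_of_fin_four {a : Fin 4} {J : Set (Fin 4)}
    (hJ : J = {a} ∨ J = {a, a + 1} ∨ J = {a, a + 1, a + 2}) :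
    J.OrdConnected ∨ Jᶜ.OrdConnected := by
  simp only [Set.ordConnected_def]
  grind

theorem not_ordConnected_or_of_fin_four (a : Fin 4) :
    ¬(({a + 2, a} : Set (Fin 4)).OrdConnected ∨ ({a + 2, a} : Set (Fin 4))ᶜ.OrdConnected) := by
  rw [not_or]
  constructor <;>
    simp only [Set.ordConnected_def, Set.subset_def, Set.mem_Icc, Set.mem_compl_iff,
      Set.mem_insert_iff, Set.mem_singleton_iff, and_imp] <;> revert a <;> decide

namespace ConnectivitySystem

/-! ### Submodularity and profiles -/

section Connectivity

variable {E : Type u} {M : ConnectivitySystem E} {m : ℕ} {A B C D : Set E}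

theorem conn_lt_succ_iff : M.conn A < (m + 1 : ℕ) ↔ M.conn A ≤ m := by
  rw [Nat.cast_add, Nat.cast_one, ENat.lt_add_one_iff (ENat.natCast_ne_top m)]

theorem conn_add_one_eq_iff : M.conn A + 1 = (m + 1 : ℕ) ↔ M.conn A = m := by
  rw [Nat.cast_add, Nat.cast_one]
  simp only [le_antisymm_iff, ENat.add_le_add_iff_right ENat.one_ne_top]

theorem conn_compl_le (hA : M.conn A ≤ m) : M.conn Aᶜ ≤ m :=
  (M.conn_compl A).trans_le hA

theorem le_conn_compl (hA : m ≤ M.conn A) : m ≤ M.conn Aᶜ :=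
  hA.trans_eq (M.conn_compl A).symm

theorem conn_union_le (hA : M.conn A ≤ m) (hB : M.conn B ≤ m) (hC : m ≤ M.conn C)
    (hinter : A ∩ B = C) (hunion : A ∪ B = D) : M.conn D ≤ m := by
  subst hinter hunion
  have h : M.conn (A ∪ B) + m ≤ m + m :=
    (add_le_add_right hC _).trans ((M.submodular A B).trans (add_le_add hA hB))
  exact (ENat.add_le_add_iff_right (ENat.natCast_ne_top m)).1 h

theorem conn_inter_le (hA : M.conn A ≤ m) (hB : M.conn B ≤ m) (hD : m ≤ M.conn D)
    (hunion : A ∪ B = D) (hinter : A ∩ B = C) : M.conn C ≤ m := by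
  rw [← M.conn_compl]
  refine conn_union_le (conn_compl_le hA) (conn_compl_le hB) (le_conn_compl hD) ?_ ?_
  · rw [← Set.compl_union, hunion]
  · rw [← Set.compl_inter, hinter]

theorem le_conn_of_union_of_inter (hB : M.conn B ≤ m) (hC : m ≤ M.conn C) (hD : m ≤ M.conn D)
    (hunion : A ∪ B = D) (hinter : A ∩ B = C) : m ≤ M.conn A := by
  subst hinter hunion
  have h : (m : ℕ∞) + m ≤ M.conn A + m :=
    (add_le_add hD hC).trans ((M.submodular A B).trans (add_le_add_right hB _))
  exact (ENat.add_le_add_iff_right (ENat.natCast_ne_top m)).1 h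

theorem exists_le_conn_of_isChain {𝒜 : Set (Set E)} (hne : 𝒜.Nonempty)
    (h𝒜 : IsChain (· ⊆ ·) 𝒜) (h : m ≤ M.conn (⋃₀ 𝒜)) : ∃ A ∈ 𝒜, m ≤ M.conn A := by
  by_contra! hlt
  cases m with
  | zero => exact hne.elim fun A hA => by simpa using hlt A hA
  | succ n =>
    exact (conn_lt_succ_iff.2 (M.limitClosed n 𝒜 hne h𝒜 fun A hA =>
      conn_lt_succ_iff.1 (hlt A hA))).not_ge h

end Connectivity

section Profiles

variable {E : Type u} {M : ConnectivitySystem E} {k m : ℕ} {P₀ : Set (Set E)} {A B : Set E}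

theorem IsProfile.univ_notMem {P : Set (Set E)} (hP : M.IsProfile k P) (hA : M.conn A < k)
    (hne : A.Nonempty) (hne_univ : A ≠ Set.univ) : Set.univ ∉ P := by
  intro huniv
  have key (B : Set E) (hB : B ∈ P) (hne : B.Nonempty) : B = Set.univ := by
    have h := hP.consistent Bᶜ Set.univ (by rwa [compl_compl]) huniv
      (Set.ssubset_univ_iff.2 (Set.compl_ne_univ.2 hne))
    rw [h, compl_compl]
  obtain ⟨B, ⟨hB, rfl | rfl⟩, -⟩ := hP.orientation A hA
  · exact hne_univ (key B hB hne)
  · exact Set.compl_ne_univ.2 hne (key Aᶜ hB (Set.nonempty_compl.2 hne_univ))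

variable (M m P₀) in
/-- An `(m + 1)`-profile with truncation `P₀` that does not contain the ground set. Elements of
a profile are thought of as small sets: the profile lives in their complements. -/
structure RegularProfile where
  sets : Set (Set E)
  isProfile : M.IsProfile (m + 1) sets
  univ_notMem : Set.univ ∉ sets
  truncation_eq : M.truncation m sets = P₀

namespace RegularProfile

instance : SetLike (M.RegularProfile m P₀) (Set E) where
  coe := sets
  coe_injective P Q h := by cases P; cases Q; congr

variable {P Q : M.RegularProfile m P₀}

theorem conn_le (hA : A ∈ P) : M.conn A ≤ m :=
  conn_lt_succ_iff.1 (P.isProfile.conn_lt A hA)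

theorem compl_mem_of_notMem (hA : A ∉ P) (hAc : M.conn A ≤ m) : Aᶜ ∈ P := by
  obtain ⟨B, ⟨hB, rfl | rfl⟩, -⟩ := P.isProfile.orientation A (conn_lt_succ_iff.2 hAc)
  exacts [absurd hB hA, hB]

theorem compl_notMem (hA : A ∈ P) : Aᶜ ∉ P := by
  intro hA'
  obtain ⟨B, -, hB⟩ := P.isProfile.orientation A (P.isProfile.conn_lt A hA)
  have hself : A = Aᶜ := (hB A ⟨hA, Or.inl rfl⟩).trans (hB Aᶜ ⟨hA', Or.inr rfl⟩).symm
  have huniv : A = Set.univ := Set.eq_univ_of_forall fun x => by grind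
  exact P.univ_notMem (huniv ▸ hA)

theorem mem_of_subset (hB : B ∈ P) (hAB : A ⊆ B) (hA : M.conn A ≤ m) : A ∈ P := by
  by_contra hAP
  have hne : A ≠ B := fun h => hAP (h ▸ hB)
  obtain rfl := P.isProfile.consistent A B (compl_mem_of_notMem hAP hA) hB (hAB.ssubset_of_ne hne)
  have huniv : Aᶜ = Set.univ := Set.eq_univ_of_forall fun x => by grind
  exact P.univ_notMem (huniv ▸ hB)

theorem union_mem (hA : A ∈ P) (hB : B ∈ P) (h : M.conn (A ∪ B) ≤ m) : A ∪ B ∈ P :=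
  by_contra fun hAB => P.isProfile.profile A hA B hB (compl_mem_of_notMem hAB h)

theorem mem_of_disjoint (hA : Aᶜ ∈ P) (h : Disjoint A B) (hB : M.conn B ≤ m) : B ∈ P :=
  mem_of_subset hA h.subset_compl_left hB

theorem compl_mem_of_subset (hA : Aᶜ ∈ P) (hAB : A ⊆ B) (hB : M.conn B ≤ m) : Bᶜ ∈ P :=
  mem_of_subset hA (Set.compl_subset_compl.2 hAB) (conn_compl_le hB)

theorem compl_inter_mem (hA : Aᶜ ∈ P) (hB : Bᶜ ∈ P) (h : M.conn (A ∩ B) ≤ m) :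
    (A ∩ B)ᶜ ∈ P := by
  rw [Set.compl_inter]
  exact union_mem hA hB (by rw [← Set.compl_inter]; exact conn_compl_le h)

theorem mem_iff_of_conn_lt (hA : M.conn A < m) : A ∈ P ↔ A ∈ Q := by
  have h (R : M.RegularProfile m P₀) : A ∈ R ↔ A ∈ P₀ :=
    (and_iff_left hA).symm.trans (Set.ext_iff.1 R.truncation_eq A)
  rw [h P, h Q]

/-- The set `A` separates `P` from `Q` if `P` lives in `A` and `Q` lives in its complement. -/
def Separates (A : Set E) (P Q : M.RegularProfile m P₀) : Prop :=
  Aᶜ ∈ P ∧ A ∈ Q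

theorem Separates.compl (h : Separates A P Q) : Separates Aᶜ Q P :=
  ⟨by rw [compl_compl]; exact h.2, h.1⟩

theorem Separates.conn_le (h : Separates A P Q) : M.conn A ≤ m :=
  RegularProfile.conn_le h.2

theorem Separates.le_conn (h : Separates A P Q) : m ≤ M.conn A := by
  by_contra! hlt
  exact compl_notMem ((mem_iff_of_conn_lt hlt).2 h.2) h.1

theorem Separates.inter (hA : Separates A P Q) (hB : Separates B P Q) :
    Separates (A ∩ B) P Q := by
  have hunion : m ≤ M.conn (A ∪ B) := by
    by_contra! hlt
    have hsep : Separates (A ∪ B) P Q :=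
      ⟨compl_mem_of_subset hA.1 Set.subset_union_left hlt.le, union_mem hA.2 hB.2 hlt.le⟩
    exact hsep.le_conn.not_gt hlt
  have hinter : M.conn (A ∩ B) ≤ m := conn_inter_le hA.conn_le hB.conn_le hunion rfl rfl
  exact ⟨compl_inter_mem hA.1 hB.1 hinter, mem_of_subset hA.2 Set.inter_subset_left hinter⟩

theorem Separates.union (hA : Separates A P Q) (hB : Separates B P Q) :
    Separates (A ∪ B) P Q := by
  simpa only [← Set.compl_union, compl_compl] using (hA.compl.inter hB.compl).compl

theorem distinguishes_iff : Distinguishes A P Q ↔ Separates A P Q ∨ Separates A Q P :=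
  or_comm.trans (or_congr_right and_comm)

end RegularProfile

theorem Distinguishes.symm {P Q : Set (Set E)} (h : Distinguishes A P Q) :
    Distinguishes A Q P :=
  Or.symm (h.imp And.symm And.symm)

theorem Distinguishes.compl {P Q : Set (Set E)} (h : Distinguishes A P Q) :
    Distinguishes Aᶜ P Q := by
  simpa only [Distinguishes, compl_compl] using Or.symm h

end Profiles

/-! ### Pseudoflowers -/

namespace PseudoFlower

variable {E : Type u} {M : ConnectivitySystem E} {k m : ℕ} {A : Set E}

theorem exists_mem_petal (Φ : M.PseudoFlower k) (e : E) : ∃ i, e ∈ Φ.petal i :=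
  Set.mem_iUnion.1 (Φ.petal_cover ▸ Set.mem_univ e)

/-- The index of the petal that contains a given element of the ground set. -/
noncomputable def index (Φ : M.PseudoFlower k) (e : E) : Φ.Index :=
  (Φ.exists_mem_petal e).choose

theorem mem_petal_iff (Φ : M.PseudoFlower k) {e : E} {i : Φ.Index} :
    e ∈ Φ.petal i ↔ Φ.index e = i := by
  have hindex : e ∈ Φ.petal (Φ.index e) := (Φ.exists_mem_petal e).choose_spec
  refine ⟨fun he => by_contra fun hne => ?_, fun h => h ▸ hindex⟩
  exact Set.disjoint_left.1 (Φ.petal_disjoint _ _ hne) hindex he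

theorem index_surjective (Φ : M.PseudoFlower k) : Function.Surjective Φ.index := fun i =>
  (Φ.petal_nonempty i).imp fun _ => Φ.mem_petal_iff.1

theorem petal_eq_preimage (Φ : M.PseudoFlower k) (i : Φ.Index) : Φ.petal i = Φ.index ⁻¹' {i} :=
  Set.ext fun _ => Φ.mem_petal_iff

theorem unionOf_eq_preimage (Φ : M.PseudoFlower k) (J : Set Φ.Index) :
    Φ.unionOf J = Φ.index ⁻¹' J := by
  ext e
  simp only [unionOf, Set.mem_iUnion, mem_petal_iff, exists_prop, Set.mem_preimage,
    exists_eq_right']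

/-- `A` is the union of a possibly trivial interval of petals. -/
def IsIntervalUnion (Φ : M.PseudoFlower k) (A : Set E) : Prop :=
  ∃ J : Set Φ.Index, IsCyclicInterval J ∧ Φ.unionOf J = A

theorem IsIntervalUnion.conn_le {Φ : M.PseudoFlower (m + 1)} (hA : Φ.IsIntervalUnion A) :
    M.conn A ≤ m := by
  obtain ⟨J, hJ, rfl⟩ := hA
  exact conn_lt_succ_iff.1 (Φ.conn_lt J hJ)

theorem IsIntervalUnion.compl {Φ : M.PseudoFlower k} (hA : Φ.IsIntervalUnion A) :
    Φ.IsIntervalUnion Aᶜ := by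
  obtain ⟨J, hJ, rfl⟩ := hA
  exact ⟨Jᶜ, hJ.compl, by simp only [unionOf_eq_preimage, Set.preimage_compl]⟩

theorem isIntervalUnion_petal (Φ : M.PseudoFlower k) (i : Φ.Index) :
    Φ.IsIntervalUnion (Φ.petal i) :=
  ⟨{i}, isCyclicInterval_singleton i, by rw [unionOf_eq_preimage, petal_eq_preimage]⟩

theorem IsIntervalUnion.of_le {Φ Ψ : M.PseudoFlower k} (h : Φ ≤ Ψ) (hA : Φ.IsIntervalUnion A) :
    Ψ.IsIntervalUnion A := by
  obtain ⟨f, hpetal, hinterval⟩ := h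
  obtain ⟨J, hJ, rfl⟩ := hA
  refine ⟨f ⁻¹' J, hinterval J hJ, ?_⟩
  have hindex : Φ.index = f ∘ Ψ.index := funext fun e =>
    Φ.mem_petal_iff.1 (hpetal _ (Ψ.mem_petal_iff.2 rfl))
  rw [unionOf_eq_preimage, unionOf_eq_preimage, hindex, Set.preimage_comp]

theorem le_of_monotone {Φ Ψ : M.PseudoFlower k} {r : LinearOrder Φ.Index}
    {s : LinearOrder Ψ.Index} (hr : IsCutOpen r) (hs : IsCutOpen s) {f : Ψ.Index → Φ.Index}
    (hf : Monotone f) (hindex : ∀ e, f (Ψ.index e) = Φ.index e) : Φ ≤ Ψ := by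
  refine ⟨f, fun i e he => ?_, fun J hJ => hs.isCyclicInterval_iff.2 ?_⟩
  · rw [Φ.mem_petal_iff, ← hindex, Ψ.mem_petal_iff.1 he]
  · exact (hr.isCyclicInterval_iff.1 hJ).imp (fun h => h.preimage_mono hf)
      fun h => h.preimage_mono hf

/-- The pseudoflower whose petals are the fibres of a map to a linear order. -/
def ofLinearOrder {L : Type u} (r : LinearOrder L) (g : E → L) (hg : Function.Surjective g)
    (h : ∀ J : Set L, J.OrdConnected → M.conn (g ⁻¹' J) < k) : M.PseudoFlower k :=
  letI := LinearOrder.toCircularOrder L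
  { Index := L
    petal := fun i => g ⁻¹' {i}
    petal_nonempty := hg
    petal_disjoint := fun i j hij => (Set.disjoint_singleton.2 hij).preimage g
    petal_cover := by rw [← Set.preimage_iUnion, Set.iUnion_of_singleton, Set.preimage_univ]
    conn_lt := by
      intro J hJ
      rw [← Set.preimage_iUnion₂, Set.biUnion_of_singleton]
      rcases (isCutOpen_toCircularOrder r).isCyclicInterval_iff.1 hJ with hJ | hJ
      · exact h J hJ
      · rw [← M.conn_compl]
        exact h Jᶜ hJ }

section Linearization

/-- A chain `𝒞` of subsets of the ground set linearizes `Φ` if it consists of the unions of the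
initial segments of the petals with respect to a linear order that arises from the cyclic order
by cutting it open and possibly reversing it. Only the properties below of such a chain are
needed. -/
structure IsLinearization (Φ : M.PseudoFlower k) (𝒞 : Set (Set E)) : Prop where
  isChain : IsChain (· ⊆ ·) 𝒞
  empty_mem : ∅ ∈ 𝒞
  univ_mem : Set.univ ∈ 𝒞
  isIntervalUnion_iff : ∀ A : Set E, Φ.IsIntervalUnion A ↔
    ∃ S ∈ 𝒞, ∃ T ∈ 𝒞, S ⊆ T ∧ (A = T \ S ∨ A = (T \ S)ᶜ)

/-- The unions of the initial segments of the petals of `Φ` with respect to a linear order. -/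
def initialUnions (Φ : M.PseudoFlower k) (r : LinearOrder Φ.Index) : Set (Set E) :=
  {A | ∃ J, @IsLowerSet Φ.Index r.toLE J ∧ Φ.index ⁻¹' J = A}

theorem isLinearization_initialUnions (Φ : M.PseudoFlower k) {r : LinearOrder Φ.Index}
    (hr : IsCutOpen r) : Φ.IsLinearization (Φ.initialUnions r) where
  isChain := by
    rintro - ⟨J, hJ, rfl⟩ - ⟨K, hK, rfl⟩ -
    exact (hJ.total hK).imp (fun h => Set.preimage_mono h) fun h => Set.preimage_mono h
  empty_mem := ⟨∅, isLowerSet_empty, rfl⟩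
  univ_mem := ⟨Set.univ, isLowerSet_univ, rfl⟩
  isIntervalUnion_iff A := by
    constructor
    · have key (J : Set Φ.Index) (hJ : J.OrdConnected) : ∃ S ∈ Φ.initialUnions r,
          ∃ T ∈ Φ.initialUnions r, S ⊆ T ∧ Φ.index ⁻¹' J = T \ S := by
        refine ⟨_, ⟨lowerClosure J \ upperClosure J, ?_, rfl⟩, _,
          ⟨lowerClosure J, (lowerClosure J).lower, rfl⟩, Set.preimage_mono Set.sdiff_subset, ?_⟩
        · exact (lowerClosure J).lower.inter (upperClosure J).upper.compl
        · rw [← Set.preimage_sdiff, Set.sdiff_sdiff_right_self, Set.inter_comm,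
            hJ.upperClosure_inter_lowerClosure]
      rintro ⟨J, hJ, rfl⟩
      rw [unionOf_eq_preimage]
      rcases hr.isCyclicInterval_iff.1 hJ with hJ | hJ
      · obtain ⟨S, hS, T, hT, hST, h⟩ := key J hJ
        exact ⟨S, hS, T, hT, hST, Or.inl h⟩
      · obtain ⟨S, hS, T, hT, hST, h⟩ := key Jᶜ hJ
        exact ⟨S, hS, T, hT, hST, Or.inr (by rw [← h, Set.preimage_compl, compl_compl])⟩
    · rintro ⟨-, ⟨J, hJ, rfl⟩, -, ⟨K, hK, rfl⟩, -, h⟩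
      have hKJ : Φ.IsIntervalUnion (Φ.index ⁻¹' K \ Φ.index ⁻¹' J) := by
        refine ⟨K \ J, hr.isCyclicInterval_of_ordConnected ?_, Φ.unionOf_eq_preimage _⟩
        exact hK.ordConnected.inter hJ.compl.ordConnected
      rcases h with rfl | rfl
      exacts [hKJ, hKJ.compl]

/-- The chain obtained from a linearization by cutting the cyclic order open at `U`. -/
def rotation (𝒞 : Set (Set E)) (U : Set E) : Set (Set E) :=
  {A | (∃ V ∈ 𝒞, U ⊆ V ∧ A = V \ U) ∨ ∃ V ∈ 𝒞, V ⊆ U ∧ A = Uᶜ ∪ V}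

namespace IsLinearization

variable {Φ : M.PseudoFlower k} {𝒞 : Set (Set E)} {S T U : Set E}

theorem isIntervalUnion_sdiff (h𝒞 : Φ.IsLinearization 𝒞) (hS : S ∈ 𝒞) (hT : T ∈ 𝒞) :
    Φ.IsIntervalUnion (T \ S) := by
  rcases h𝒞.isChain.total hS hT with h | h
  · exact (h𝒞.isIntervalUnion_iff _).2 ⟨S, hS, T, hT, h, Or.inl rfl⟩
  · exact (h𝒞.isIntervalUnion_iff _).2 ⟨T, hT, T, hT, subset_rfl, Or.inl (by grind)⟩

theorem isIntervalUnion_mem (h𝒞 : Φ.IsLinearization 𝒞) (hT : T ∈ 𝒞) : Φ.IsIntervalUnion T := by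
  simpa only [Set.sdiff_empty] using h𝒞.isIntervalUnion_sdiff h𝒞.empty_mem hT

theorem compl (h𝒞 : Φ.IsLinearization 𝒞) : Φ.IsLinearization {A | Aᶜ ∈ 𝒞} where
  isChain _ hS _ hT _ :=
    (h𝒞.isChain.total hS hT).symm.imp Set.compl_subset_compl.1 Set.compl_subset_compl.1
  empty_mem := by simpa using h𝒞.univ_mem
  univ_mem := by simpa using h𝒞.empty_mem
  isIntervalUnion_iff A := by
    rw [h𝒞.isIntervalUnion_iff]
    constructor
    · rintro ⟨S, hS, T, hT, hST, h⟩
      exact ⟨Tᶜ, by simpa using hT, Sᶜ, by simpa using hS, by grind, by grind⟩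
    · rintro ⟨S, hS, T, hT, hST, h⟩
      exact ⟨Tᶜ, hT, Sᶜ, hS, by grind, by grind⟩

theorem rotation (h𝒞 : Φ.IsLinearization 𝒞) (hU : U ∈ 𝒞) :
    Φ.IsLinearization (PseudoFlower.rotation 𝒞 U) where
  isChain := by
    rintro - (⟨V, hV, -, rfl⟩ | ⟨V, hV, -, rfl⟩) - (⟨W, hW, -, rfl⟩ | ⟨W, hW, -, rfl⟩) -
    · exact (h𝒞.isChain.total hV hW).imp (by grind) (by grind)
    · exact Or.inl (by grind)
    · exact Or.inr (by grind)
    · exact (h𝒞.isChain.total hV hW).imp (by grind) (by grind)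
  empty_mem := Or.inl ⟨U, hU, subset_rfl, by grind⟩
  univ_mem := Or.inr ⟨U, hU, subset_rfl, by grind⟩
  isIntervalUnion_iff A := by
    constructor
    · rw [h𝒞.isIntervalUnion_iff]
      rintro ⟨S, hS, T, hT, hST, h⟩
      rcases h𝒞.isChain.total hU hS with hUS | hSU
      · exact ⟨S \ U, Or.inl ⟨S, hS, hUS, rfl⟩, T \ U, Or.inl ⟨T, hT, hUS.trans hST, rfl⟩,
          by grind, by grind⟩
      rcases h𝒞.isChain.total hU hT with hUT | hTU
      · exact ⟨T \ U, Or.inl ⟨T, hT, hUT, rfl⟩, Uᶜ ∪ S, Or.inr ⟨S, hS, hSU, rfl⟩,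
          by grind, by grind⟩
      · exact ⟨Uᶜ ∪ S, Or.inr ⟨S, hS, hSU, rfl⟩, Uᶜ ∪ T, Or.inr ⟨T, hT, hTU, rfl⟩,
          by grind, by grind⟩
    · have key (V W : Set E) (hV : V ∈ 𝒞) (hW : W ∈ 𝒞) (h : A = W \ V ∨ A = (W \ V)ᶜ) :
          Φ.IsIntervalUnion A := by
        have hWV := h𝒞.isIntervalUnion_sdiff hV hW
        rcases h with rfl | rfl
        exacts [hWV, hWV.compl]
      rintro ⟨-, ⟨V, hV, hUV, rfl⟩ | ⟨V, hV, -, rfl⟩, -,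
        ⟨W, hW, hUW, rfl⟩ | ⟨W, hW, hWU, rfl⟩, -, h⟩
      · exact key V W hV hW (by grind)
      · exact key W V hW hV (by grind)
      · exact key V V hV hV (by grind)
      · exact key V W hV hW (by grind)

end IsLinearization

end Linearization

end PseudoFlower

namespace RegularProfile

variable {E : Type u} {M : ConnectivitySystem E} {m : ℕ} {P₀ : Set (Set E)} {A S T : Set E}
  {P P' Q Q' : M.RegularProfile m P₀}

theorem distinguishes_iff_mem (hA : M.conn A ≤ m) :
    Distinguishes A P Q ↔ ¬(A ∈ P ↔ A ∈ Q) := by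
  have h (R : M.RegularProfile m P₀) : Aᶜ ∈ R ↔ A ∉ R :=
    ⟨fun hAc hAR => compl_notMem hAR hAc, fun hAR => compl_mem_of_notMem hAR hA⟩
  simp only [Distinguishes, SetLike.mem_coe, h]
  tauto

theorem sdiff_mem_iff (hST : S ⊆ T) (hS : M.conn S ≤ m) (hT : M.conn T ≤ m)
    (hTS : M.conn (T \ S) ≤ m) : T \ S ∈ P ↔ T ∈ P ∨ S ∉ P := by
  constructor
  · refine fun h => or_iff_not_imp_right.2 fun hSP => ?_
    have hunion : S ∪ T \ S = T := Set.union_sdiff_cancel hST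
    exact hunion ▸ union_mem (not_not.1 hSP) h (hunion.symm ▸ hT)
  · rintro (h | h)
    · exact mem_of_subset h Set.sdiff_subset hTS
    · exact mem_of_subset (compl_mem_of_notMem h hS) (fun x hx => hx.2) hTS

theorem distinguishes_of_sdiff (hST : S ⊆ T) (hS : M.conn S ≤ m) (hT : M.conn T ≤ m)
    (hTS : M.conn (T \ S) ≤ m) (h : Distinguishes (T \ S) P Q) :
    Distinguishes S P Q ∨ Distinguishes T P Q := by
  rw [distinguishes_iff_mem hTS, sdiff_mem_iff hST hS hT hTS, sdiff_mem_iff hST hS hT hTS] at h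
  rw [distinguishes_iff_mem hS, distinguishes_iff_mem hT]
  tauto

theorem exists_distinguishes_of_subset (hST : S ⊆ T) (hTS : M.conn (T \ S) ≤ m)
    (hS : M.conn S ≤ m) (hT : M.conn T ≤ m) (hSP : Distinguishes S P P')
    (hTQ : Distinguishes T Q Q') :
    ∃ A ∈ ({S, T, T \ S} : Set (Set E)), Distinguishes A P P' ∧ Distinguishes A Q Q' := by
  have hmono (R : M.RegularProfile m P₀) (hR : T ∈ R) : S ∈ R := mem_of_subset hR hST hS
  simp only [Set.mem_insert_iff, Set.mem_singleton_iff, exists_eq_or_imp, exists_eq_left,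
    distinguishes_iff_mem hS, distinguishes_iff_mem hT, distinguishes_iff_mem hTS,
    sdiff_mem_iff hST hS hT hTS] at hSP hTQ ⊢
  grind

end RegularProfile

namespace PseudoFlower

variable {E : Type u} {M : ConnectivitySystem E} {k m : ℕ}

/-- Some union of an interval of petals distinguishes `P` and `Q`. In contrast to
`DisplaysDistinction`, trivial intervals are allowed. -/
def IntervalDistinguishes (Φ : M.PseudoFlower k) (P Q : Set (Set E)) : Prop :=
  ∃ J : Set Φ.Index, IsCyclicInterval J ∧ Distinguishes (Φ.unionOf J) P Q

theorem intervalDistinguishes_iff {Φ : M.PseudoFlower k} {P Q : Set (Set E)} :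
    Φ.IntervalDistinguishes P Q ↔ ∃ A, Φ.IsIntervalUnion A ∧ Distinguishes A P Q :=
  ⟨fun ⟨J, hJ, h⟩ => ⟨_, ⟨J, hJ, rfl⟩, h⟩, fun ⟨_, ⟨J, hJ, hA⟩, h⟩ => ⟨J, hJ, hA ▸ h⟩⟩

theorem IntervalDistinguishes.symm {Φ : M.PseudoFlower k} {P Q : Set (Set E)}
    (h : Φ.IntervalDistinguishes P Q) : Φ.IntervalDistinguishes Q P :=
  h.imp fun _ => And.imp_right Distinguishes.symm

theorem IntervalDistinguishes.left_or_right {Φ : M.PseudoFlower k} {P Q R : Set (Set E)}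
    (hP : M.IsProfile k P) (h : Φ.IntervalDistinguishes Q R) :
    Φ.IntervalDistinguishes P Q ∨ Φ.IntervalDistinguishes P R := by
  obtain ⟨J, hJ, hQR⟩ := h
  obtain ⟨A, ⟨hA, rfl | rfl⟩, -⟩ := hP.orientation (Φ.unionOf J) (Φ.conn_lt J hJ)
  · exact hQR.symm.imp (fun h => ⟨J, hJ, Or.inl ⟨hA, h.2⟩⟩) fun h => ⟨J, hJ, Or.inl ⟨hA, h.1⟩⟩
  · exact hQR.imp (fun h => ⟨J, hJ, Or.inr ⟨hA, h.1⟩⟩) fun h => ⟨J, hJ, Or.inr ⟨hA, h.2⟩⟩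

theorem DisplaysDistinction.intervalDistinguishes {Φ : M.PseudoFlower k} {P Q : Set (Set E)}
    (h : Φ.DisplaysDistinction P Q) : Φ.IntervalDistinguishes P Q := by
  obtain ⟨A, ⟨J, hJ, -, -, rfl⟩, hA⟩ := h
  exact ⟨J, hJ, hA⟩

theorem DistinguishesThree.exists_pair {Φ : M.PseudoFlower k} {Pset : Set (Set (Set E))}
    {P : Set (Set E)} (h : Φ.DistinguishesThree Pset) (hP : M.IsProfile k P) :
    ∃ Q ∈ Pset, ∃ R ∈ Pset, Φ.IntervalDistinguishes P Q ∧ Φ.IntervalDistinguishes P R ∧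
      Φ.IntervalDistinguishes Q R := by
  obtain ⟨p₁, hp₁, p₂, hp₂, p₃, hp₃, h₁₂, h₁₃, h₂₃⟩ := h
  replace h₁₂ := h₁₂.intervalDistinguishes
  replace h₁₃ := h₁₃.intervalDistinguishes
  replace h₂₃ := h₂₃.intervalDistinguishes
  by_cases hP₁ : Φ.IntervalDistinguishes P p₁
  · rcases h₂₃.left_or_right hP with hP₂ | hP₃
    · exact ⟨p₁, hp₁, p₂, hp₂, hP₁, hP₂, h₁₂⟩
    · exact ⟨p₁, hp₁, p₃, hp₃, hP₁, hP₃, h₁₃⟩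
  · exact ⟨p₂, hp₂, p₃, hp₃, (h₁₂.left_or_right hP).resolve_left hP₁,
      (h₁₃.left_or_right hP).resolve_left hP₁, h₂₃⟩

variable {P₀ : Set (Set E)} {P P' Q Q' : M.RegularProfile m P₀} {Φ : M.PseudoFlower (m + 1)}

open RegularProfile

theorem Displays.exists_regularProfile {A : Set E} {R : Set (Set E)} (hA : Φ.Displays A)
    (hR : M.IsProfile (m + 1) R) (htrunc : M.truncation m R = P₀) :
    ∃ R' : M.RegularProfile m P₀, (R' : Set (Set E)) = R := by
  obtain ⟨J, hJ, hJ_nonempty, hJ_univ, rfl⟩ := hA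
  have hJ_lt := Φ.conn_lt J hJ
  refine ⟨⟨R, hR, hR.univ_notMem hJ_lt ?_ fun huniv => hJ_univ ?_, htrunc⟩, rfl⟩
  · rw [← unionOf, unionOf_eq_preimage]
    exact hJ_nonempty.preimage Φ.index_surjective
  · rw [← unionOf, unionOf_eq_preimage] at huniv
    exact Φ.index_surjective.preimage_injective (huniv.trans Set.preimage_univ.symm)

theorem IsLinearization.exists_distinguishes {𝒞 : Set (Set E)} (h𝒞 : Φ.IsLinearization 𝒞)
    (h : Φ.IntervalDistinguishes P Q) : ∃ T ∈ 𝒞, Distinguishes T P Q := by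
  obtain ⟨A, hA, h⟩ := intervalDistinguishes_iff.1 h
  obtain ⟨S, hS, T, hT, hST, hAST⟩ := (h𝒞.isIntervalUnion_iff A).1 hA
  have hTS : Distinguishes (T \ S) P Q := by
    rcases hAST with rfl | rfl
    exacts [h, compl_compl (T \ S) ▸ h.compl]
  rcases distinguishes_of_sdiff hST (h𝒞.isIntervalUnion_mem hS).conn_le
    (h𝒞.isIntervalUnion_mem hT).conn_le (h𝒞.isIntervalUnion_sdiff hS hT).conn_le hTS with h | h
  exacts [⟨S, hS, h⟩, ⟨T, hT, h⟩]

theorem exists_isIntervalUnion_distinguishes (hP : Φ.IntervalDistinguishes P P')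
    (hQ : Φ.IntervalDistinguishes Q Q') :
    ∃ A, Φ.IsIntervalUnion A ∧ Distinguishes A P P' ∧ Distinguishes A Q Q' := by
  obtain ⟨r, hr⟩ := exists_isCutOpen Φ.Index
  have h𝒞 := Φ.isLinearization_initialUnions hr
  have hconn (S) (hS : S ∈ Φ.initialUnions r) := (h𝒞.isIntervalUnion_mem hS).conn_le
  have key {S T} (hS : S ∈ Φ.initialUnions r) (hT : T ∈ Φ.initialUnions r)
      {A} (hA : A ∈ ({S, T, T \ S} : Set (Set E))) : Φ.IsIntervalUnion A := by
    obtain rfl | rfl | rfl := hA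
    exacts [h𝒞.isIntervalUnion_mem hS, h𝒞.isIntervalUnion_mem hT, h𝒞.isIntervalUnion_sdiff hS hT]
  obtain ⟨S, hS, hSP⟩ := h𝒞.exists_distinguishes hP
  obtain ⟨T, hT, hTQ⟩ := h𝒞.exists_distinguishes hQ
  rcases h𝒞.isChain.total hS hT with hST | hTS
  · obtain ⟨A, hA, hAP, hAQ⟩ := exists_distinguishes_of_subset hST
      (h𝒞.isIntervalUnion_sdiff hS hT).conn_le (hconn S hS) (hconn T hT) hSP hTQ
    exact ⟨A, key hS hT hA, hAP, hAQ⟩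
  · obtain ⟨A, hA, hAQ, hAP⟩ := exists_distinguishes_of_subset hTS
      (h𝒞.isIntervalUnion_sdiff hT hS).conn_le (hconn T hT) (hconn S hS) hTQ hSP
    exact ⟨A, key hT hS hA, hAP, hAQ⟩

end PseudoFlower

/-! ### Profiles at a cut -/

section Exhaustion

variable {E : Type u} {M : ConnectivitySystem E} {m : ℕ} {𝒯 : Set (Set E)} {S T : Set E}

variable (M m) in
/-- A chain that exhausts the ground set and whose differences have connectivity at most `m`. Its
elements are thought of as the initial segments of a linear order, with the ground set itself
excluded. -/
structure IsExhaustion (𝒯 : Set (Set E)) : Prop where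
  isChain : IsChain (· ⊆ ·) 𝒯
  empty_mem : ∅ ∈ 𝒯
  sUnion_eq : ⋃₀ 𝒯 = Set.univ
  conn_sdiff_le : ∀ S ∈ 𝒯, ∀ T ∈ 𝒯, M.conn (T \ S) ≤ m

namespace IsExhaustion

theorem conn_le (h𝒯 : M.IsExhaustion m 𝒯) (hT : T ∈ 𝒯) : M.conn T ≤ m := by
  simpa only [Set.sdiff_empty] using h𝒯.conn_sdiff_le ∅ h𝒯.empty_mem T hT

theorem exists_superset (h𝒯 : M.IsExhaustion m 𝒯) (hS : S ∈ 𝒯) (hT : T ∈ 𝒯) :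
    ∃ R ∈ 𝒯, S ⊆ R ∧ T ⊆ R :=
  h𝒯.isChain.directedOn S hS T hT

end IsExhaustion

end Exhaustion

namespace PseudoFlower

variable {E : Type u} {M : ConnectivitySystem E} {m : ℕ} {P₀ : Set (Set E)}
  {Φ : M.PseudoFlower (m + 1)} {𝒞 : Set (Set E)} {P : M.RegularProfile m P₀} {U : Set E}

open RegularProfile

theorem IsLinearization.mem_of_mem_rotation (h𝒞 : Φ.IsLinearization 𝒞) (hU : U ∈ 𝒞)
    (hUP : U ∉ P) (hcover : ∀ x ∈ U, ∃ T ∈ 𝒞, T ∈ P ∧ x ∈ T) {A : Set E}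
    (hA : A ∈ PseudoFlower.rotation 𝒞 U) (hne : A ≠ Set.univ) : A ∈ P := by
  have hUc : Uᶜ ∈ P := compl_mem_of_notMem hUP (h𝒞.isIntervalUnion_mem hU).conn_le
  have hconn := ((h𝒞.rotation hU).isIntervalUnion_mem hA).conn_le
  obtain ⟨V, -, -, rfl⟩ | ⟨V, hV, -, rfl⟩ := hA
  · exact mem_of_subset hUc (fun x hx => hx.2) hconn
  · obtain ⟨x, hx⟩ := (Set.ne_univ_iff_exists_notMem _).1 hne
    obtain ⟨T, hT, hTP, hxT⟩ := hcover x (by grind)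
    have hVT : V ⊆ T := (h𝒞.isChain.total hV hT).resolve_right (by grind)
    exact union_mem hUc (mem_of_subset hTP hVT (h𝒞.isIntervalUnion_mem hV).conn_le) hconn

theorem IsLinearization.isExhaustion_rotation (h𝒞 : Φ.IsLinearization 𝒞) (hU : U ∈ 𝒞)
    (hUP : U ∉ P) (hcover : ∀ x ∈ U, ∃ T ∈ 𝒞, T ∈ P ∧ x ∈ T) :
    M.IsExhaustion m (PseudoFlower.rotation 𝒞 U \ {Set.univ}) where
  isChain := (h𝒞.rotation hU).isChain.mono Set.sdiff_subset
  empty_mem := by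
    refine ⟨(h𝒞.rotation hU).empty_mem, fun h : ∅ = Set.univ => hUP ?_⟩
    have hempty (A : Set E) : A = ∅ := Set.subset_eq_empty (Set.subset_univ A) h.symm
    have hUc := compl_mem_of_notMem hUP (h𝒞.isIntervalUnion_mem hU).conn_le
    rwa [hempty Uᶜ, ← hempty U] at hUc
  sUnion_eq := by
    have hconn := (h𝒞.isIntervalUnion_mem hU).conn_le
    refine Set.eq_univ_of_forall fun x => ?_
    by_cases hx : x ∈ U
    · obtain ⟨T, hT, hTP, hxT⟩ := hcover x hx
      obtain ⟨y, hyU, hyT⟩ := Set.not_subset.1 fun hUT => hUP (mem_of_subset hTP hUT hconn)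
      have hTU : T ⊆ U := (h𝒞.isChain.total hT hU).resolve_right fun hUT => hyT (hUT hyU)
      have hne := (Set.ne_univ_iff_exists_notMem (Uᶜ ∪ T)).2 ⟨y, by grind⟩
      exact ⟨Uᶜ ∪ T, ⟨Or.inr ⟨T, hT, hTU, rfl⟩, hne⟩, Or.inr hxT⟩
    · have hne : U.Nonempty := by
        by_contra! h
        obtain rfl := h
        exact P.univ_notMem (Set.compl_empty ▸ compl_mem_of_notMem hUP hconn)
      refine ⟨Uᶜ ∪ ∅, ⟨Or.inr ⟨∅, h𝒞.empty_mem, Set.empty_subset U, rfl⟩, ?_⟩, Or.inl hx⟩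
      simpa using hne.ne_empty
  conn_sdiff_le S hS T hT := ((h𝒞.rotation hU).isIntervalUnion_sdiff hS.1 hT.1).conn_le

theorem exists_isLinearization_cut (hpetal : ∀ i, Φ.petal i ∈ P) :
    ∃ 𝒞, Φ.IsLinearization 𝒞 ∧ ∃ U ∈ 𝒞, U ∉ P ∧ ∀ x ∈ U, ∃ T ∈ 𝒞, T ∈ P ∧ x ∈ T := by
  obtain ⟨r, hr⟩ := exists_isCutOpen Φ.Index
  have h𝒞 := Φ.isLinearization_initialUnions hr
  have hmem (J : Set Φ.Index) (hJ : IsLowerSet J) : Φ.index ⁻¹' J ∈ Φ.initialUnions r :=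
    ⟨J, hJ, rfl⟩
  have hconn (J : Set Φ.Index) (hJ : IsLowerSet J) : M.conn (Φ.index ⁻¹' J) ≤ m :=
    (h𝒞.isIntervalUnion_mem (hmem J hJ)).conn_le
  set K : Set Φ.Index := {i | Φ.index ⁻¹' Set.Iic i ∈ P}
  have hKlower : IsLowerSet K := fun i j hji hi => mem_of_subset hi
    (Set.preimage_mono (Set.Iic_subset_Iic.2 hji)) (hconn _ (isLowerSet_Iic j))
  by_cases hKP : Φ.index ⁻¹' K ∈ P
  · refine ⟨_, h𝒞.compl, (Φ.index ⁻¹' K)ᶜ, ?_, compl_notMem hKP, fun x hx => ?_⟩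
    · simpa only [Set.mem_ofPred_eq, compl_compl] using hmem K hKlower
    · have hIio : Φ.index ⁻¹' Set.Iio (Φ.index x) ∉ P := by
        intro h
        have hIic : Φ.index ⁻¹' Set.Iio (Φ.index x) ∪ Φ.petal (Φ.index x) =
            Φ.index ⁻¹' Set.Iic (Φ.index x) := by
          rw [petal_eq_preimage, ← Set.preimage_union, Set.Iio_union_right]
        have hunion := union_mem h (hpetal (Φ.index x))
        rw [hIic] at hunion
        exact hx (hunion (hconn _ (isLowerSet_Iic _)))
      refine ⟨(Φ.index ⁻¹' Set.Iio (Φ.index x))ᶜ, ?_, ?_, lt_irrefl (Φ.index x)⟩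
      · simpa only [Set.mem_ofPred_eq, compl_compl] using hmem _ (isLowerSet_Iio (Φ.index x))
      · exact compl_mem_of_notMem hIio (hconn _ (isLowerSet_Iio _))
  · exact ⟨_, h𝒞, Φ.index ⁻¹' K, hmem K hKlower, hKP, fun x hx =>
      ⟨_, hmem _ (isLowerSet_Iic (Φ.index x)), hx, le_refl (Φ.index x)⟩⟩

theorem exists_isExhaustion (hpetal : ∀ i, Φ.petal i ∈ P) :
    ∃ 𝒞, Φ.IsLinearization 𝒞 ∧ M.IsExhaustion m (𝒞 \ {Set.univ}) ∧
      ∀ T ∈ 𝒞, T ≠ Set.univ → T ∈ P := by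
  obtain ⟨𝒞, h𝒞, U, hU, hUP, hcover⟩ := exists_isLinearization_cut hpetal
  exact ⟨rotation 𝒞 U, h𝒞.rotation hU, h𝒞.isExhaustion_rotation hU hUP hcover,
    fun T => h𝒞.mem_of_mem_rotation hU hUP hcover⟩

end PseudoFlower

section Arcs

variable {E : Type u} {M : ConnectivitySystem E} {m : ℕ} {B X Y s₁ s₂ t₀ t₁ t₂ : Set E}

theorem conn_half_union_le (h₀₁ : t₀ ⊆ t₁) (h₁₂ : t₁ ⊆ t₂)
    (ht₀ : m ≤ M.conn t₀) (hc : M.conn (t₁ \ t₀) ≤ m) (hcY : m ≤ M.conn ((t₁ \ t₀) ∩ Y))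
    (hG : M.conn ((t₂ \ t₀) ∩ Y ∪ t₂ᶜ) ≤ m) (hH : M.conn ((t₂ \ t₀) \ Y ∪ t₂ᶜ) ≤ m) :
    M.conn ((t₁ \ t₀) \ Y ∪ t₂ᶜ) ≤ m := by
  have hcG : M.conn ((t₁ \ t₀) ∪ ((t₂ \ t₀) ∩ Y) ∪ t₂ᶜ) ≤ m :=
    conn_union_le hc hG hcY (by grind) (by grind)
  exact conn_inter_le hcG hH (le_conn_compl ht₀) (by grind) (by grind)

/-- The sets `X`, `t₀ \ X`, `t₁ \ t₀`, `t₂ \ t₁` and `t₂ᶜ` are successive arcs of a cyclic order,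
so the union skips an arc. The halves of `t₁ \ t₀` inside and outside `Y` are joined to `t₂ᶜ` one
at a time. -/
theorem conn_skip_le (hX : X ⊆ t₀) (h₀₁ : t₀ ⊆ t₁) (h₁₂ : t₁ ⊆ t₂) (cX : m ≤ M.conn X)
    (ht₀ : M.conn t₀ = m) (ht₂ : M.conn t₂ = m) (hc : M.conn (t₁ \ t₀) ≤ m)
    (hW₀ : m ≤ M.conn (X ∪ t₀ᶜ)) (hW₂ : M.conn (X ∪ t₂ᶜ) ≤ m)
    (hZ₀ : M.conn (X ∪ (t₀ᶜ ∩ Y)) ≤ m) (hZ₂ : m ≤ M.conn (X ∪ (t₂ᶜ ∩ Y)))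
    (heY : m ≤ M.conn (t₂ᶜ ∩ Yᶜ))
    (hcY : m ≤ M.conn ((t₁ \ t₀) ∩ Y)) (hcYc : m ≤ M.conn ((t₁ \ t₀) ∩ Yᶜ)) :
    M.conn ((t₁ \ t₀) ∪ t₂ᶜ) ≤ m := by
  have hN : M.conn (X ∪ (t₀ᶜ ∩ Y) ∪ t₂ᶜ) ≤ m :=
    conn_union_le hZ₀ hW₂ hZ₂ (by grind) (by grind)
  have hG : M.conn ((t₂ \ t₀) ∩ Y ∪ t₂ᶜ) ≤ m :=
    conn_inter_le hN (conn_compl_le ht₀.le) hW₀ (by grind) (by grind)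
  have hN' : M.conn ((t₂ \ X) \ (t₀ᶜ ∩ Y) ∪ t₂ᶜ) ≤ m :=
    conn_union_le (conn_compl_le hZ₀) (conn_compl_le ht₂.le) heY (by grind) (by grind)
  have hH : M.conn ((t₂ \ t₀) \ Y ∪ t₂ᶜ) ≤ m :=
    conn_inter_le hN' (conn_compl_le ht₀.le) (le_conn_compl cX) (by grind) (by grind)
  have hleft := conn_half_union_le h₀₁ h₁₂ ht₀.ge hc hcY hG hH
  have hright := conn_half_union_le (Y := Yᶜ) h₀₁ h₁₂ ht₀.ge hc hcYc
    (by rwa [← Set.sdiff_eq]) (by rwa [Set.sdiff_compl])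
  exact conn_union_le hleft hright (le_conn_compl ht₂.ge) (by grind) (by grind)

theorem conn_opposite_le (hs : s₁ ⊆ s₂) (h₀ : s₂ ⊆ t₀) (h₀₁ : t₀ ⊆ t₁) (h₁₂ : t₁ ⊆ t₂)
    (hB : t₀ᶜ ⊆ B) (hdisj : Disjoint B (s₂ \ s₁)) (hBc : M.conn B ≤ m)
    (hskip : M.conn ((t₁ \ t₀) ∪ t₂ᶜ) ≤ m) (ht₂ : m ≤ M.conn t₂)
    (h₁₀ : m ≤ M.conn (t₁ \ t₀)) (h₂₁ : m ≤ M.conn (t₂ \ t₁))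
    (h₂s : M.conn (t₂ \ s₁) ≤ m) (h₁s : M.conn (t₁ \ s₂) ≤ m) :
    M.conn ((s₂ \ s₁) ∪ B) ≤ m := by
  have h₁ : M.conn (s₁ ∪ (t₁ \ t₀) ∪ t₂ᶜ) ≤ m :=
    conn_union_le hskip (conn_compl_le h₂s) (le_conn_compl ht₂) (by grind) (by grind)
  have h₂ : M.conn ((s₂ \ s₁) ∪ (t₂ \ t₁))ᶜ ≤ m :=
    conn_union_le h₁ h₁s h₁₀ (by grind) (by grind)
  exact conn_union_le (conn_compl_le h₂) hBc h₂₁ (by grind) (by grind)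

end Arcs

section End

variable {E : Type u} {M : ConnectivitySystem E} {m : ℕ} {P₀ : Set (Set E)}
  {P Q q r : M.RegularProfile m P₀} {𝒯 : Set (Set E)} {B S T X Y : Set E}

open RegularProfile

/-- The situation in which `P` and `Q` both live at the end of the exhaustion `𝒯`, while `q` and
`r` live in its member `S` and are separated by the initial segment `X`, and `Y` separates both
`q` from `r` and `Q` from `P`. -/
structure CrossesAtEnd (P Q q r : M.RegularProfile m P₀) (𝒯 : Set (Set E)) (S X Y : Set E) :
    Prop where
  isExhaustion : M.IsExhaustion m 𝒯
  mem_left : ∀ T ∈ 𝒯, T ∈ P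
  mem_right : ∀ T ∈ 𝒯, T ∈ Q
  mem : S ∈ 𝒯
  compl_mem_left : Sᶜ ∈ q
  compl_mem_right : Sᶜ ∈ r
  mem_separator : X ∈ 𝒯
  separates_separator : Separates X q r
  separates_inner : Separates Y q r
  separates_outer : Separates Y Q P

namespace CrossesAtEnd

variable (h : CrossesAtEnd P Q q r 𝒯 S X Y) (hT : T ∈ 𝒯) (hST : S ⊆ T)

include h

theorem separator_subset : X ⊆ S :=
  (h.isExhaustion.isChain.total h.mem_separator h.mem).resolve_right fun hSX =>
    compl_notMem (mem_of_subset h.separates_separator.2 hSX (h.isExhaustion.conn_le h.mem))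
      h.compl_mem_right

theorem le_conn_of_subset {A : Set E} (hT : T ∈ 𝒯) (hSA : S ⊆ A) (hAT : A ⊆ T) :
    m ≤ M.conn A := by
  by_contra! hlt
  have hA : A ∈ r := (mem_iff_of_conn_lt hlt).1 (mem_of_subset (h.mem_left T hT) hAT hlt.le)
  exact compl_notMem (mem_of_subset hA hSA (h.isExhaustion.conn_le h.mem)) h.compl_mem_right

include hT hST

theorem separates_tail_left : Separates Tᶜ P q :=
  ⟨by simpa only [compl_compl] using h.mem_left T hT,
    compl_mem_of_subset h.compl_mem_left hST (h.isExhaustion.conn_le hT)⟩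

theorem separates_tail_right : Separates Tᶜ Q r :=
  ⟨by simpa only [compl_compl] using h.mem_right T hT,
    compl_mem_of_subset h.compl_mem_right hST (h.isExhaustion.conn_le hT)⟩

theorem separates_separator_union_tail : Separates (X ∪ Tᶜ) Q r := by
  have hcompl : (X ∪ Tᶜ)ᶜ = T \ X := by grind
  have hconn := h.isExhaustion.conn_sdiff_le X h.mem_separator T hT
  refine ⟨?_, union_mem h.separates_separator.2 (h.separates_tail_right hT hST).2 ?_⟩
  · rw [hcompl]
    exact mem_of_subset (h.mem_right T hT) Set.sdiff_subset hconn
  · rw [← M.conn_compl, hcompl]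
    exact hconn

theorem separates_separator_union_tail_inter : Separates (X ∪ (Tᶜ ∩ Y)) Q r := by
  have hXY := h.separates_separator.union h.separates_inner
  have hXY' : Separates (X ∪ Y) Q r :=
    ⟨compl_mem_of_subset h.separates_outer.1 Set.subset_union_right hXY.conn_le, hXY.2⟩
  rw [Set.union_inter_distrib_left]
  exact (h.separates_separator_union_tail hT hST).inter hXY'

theorem le_conn_tail_inter : m ≤ M.conn (Tᶜ ∩ Y) := by
  have hXT := h.separator_subset.trans hST
  have heq : Tᶜ ∩ Y = Tᶜ ∩ (X ∪ (Tᶜ ∩ Y)) := by grind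
  rw [heq]
  exact ((h.separates_tail_right hT hST).inter
    (h.separates_separator_union_tail_inter hT hST)).le_conn

theorem le_conn_tail_sdiff : m ≤ M.conn (Tᶜ ∩ Yᶜ) := by
  have hXT := h.separator_subset.trans hST
  have hconn := (h.separates_separator_union_tail_inter hT hST).conn_le
  have hXY := union_mem (h.mem_left X h.mem_separator) h.separates_outer.2
    (h.separates_separator.union h.separates_inner).conn_le
  have hsep : Separates (X ∪ (Tᶜ ∩ Y)) q P :=
    ⟨compl_mem_of_subset h.separates_separator.1 Set.subset_union_left hconn,
      mem_of_subset hXY (by grind) hconn⟩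
  have heq : Tᶜ ∩ Yᶜ = Tᶜ ∩ (X ∪ (Tᶜ ∩ Y))ᶜ := by grind
  rw [heq]
  exact ((h.separates_tail_left hT hST).inter hsep.compl).le_conn

theorem exists_le_conn_sdiff_inter (hB : m ≤ M.conn (Tᶜ ∩ B)) :
    ∃ T₁ ∈ 𝒯, T ⊆ T₁ ∧ ∀ T' ∈ 𝒯, T₁ ⊆ T' → m ≤ M.conn ((T' \ T) ∩ B) := by
  obtain ⟨R, hR, hRB⟩ : ∃ R ∈ 𝒯, m ≤ M.conn ((R \ T) ∩ B) := by
    have hunion : ⋃₀ ((fun R => (R \ T) ∩ B) '' 𝒯) = Tᶜ ∩ B := by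
      ext x
      obtain ⟨R, hR, hxR⟩ : x ∈ ⋃₀ 𝒯 := h.isExhaustion.sUnion_eq ▸ Set.mem_univ x
      rw [Set.sUnion_image, Set.mem_iUnion₂]
      exact ⟨fun ⟨_, _, hx⟩ => ⟨hx.1.2, hx.2⟩, fun hx => ⟨R, hR, ⟨hxR, hx.1⟩, hx.2⟩⟩
    have hchain : IsChain (· ⊆ ·) ((fun R => (R \ T) ∩ B) '' 𝒯) :=
      h.isExhaustion.isChain.image_of_map_rel _ _ _ fun R R' hRR' => by grind
    have hne : 𝒯.Nonempty := ⟨T, hT⟩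
    simpa using exists_le_conn_of_isChain (hne.image _) hchain (hunion ▸ hB)
  obtain ⟨T₁, hT₁, hTT₁, heq⟩ : ∃ T₁ ∈ 𝒯, T ⊆ T₁ ∧ (T₁ \ T) ∩ B = (R \ T) ∩ B := by
    rcases h.isExhaustion.isChain.total hT hR with hTR | hRT
    · exact ⟨R, hR, hTR, rfl⟩
    · exact ⟨T, hT, subset_rfl, by grind⟩
  refine ⟨T₁, hT₁, hTT₁, fun T' hT' hTT' => ?_⟩
  have hmid : m ≤ M.conn (((T' \ T) ∩ B) ∪ T₁) :=
    h.le_conn_of_subset hT' (by grind) (by grind)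
  exact le_conn_of_union_of_inter (h.isExhaustion.conn_le hT₁) (heq ▸ hRB) hmid rfl (by grind)

theorem exists_le_conn_sdiff :
    ∃ T₁ ∈ 𝒯, T ⊆ T₁ ∧ ∀ T' ∈ 𝒯, T₁ ⊆ T' → m ≤ M.conn (T' \ T) := by
  have hTc := le_conn_compl (h.le_conn_of_subset hT hST subset_rfl)
  simpa only [Set.inter_univ] using
    h.exists_le_conn_sdiff_inter hT hST (B := Set.univ) (by rwa [Set.inter_univ])

theorem exists_le_conn_sdiff_and_inter : ∃ T₁ ∈ 𝒯, T ⊆ T₁ ∧ m ≤ M.conn (T₁ \ T) ∧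
    m ≤ M.conn ((T₁ \ T) ∩ Y) ∧ m ≤ M.conn ((T₁ \ T) ∩ Yᶜ) := by
  obtain ⟨R, hR, hTR, hRT⟩ := h.exists_le_conn_sdiff hT hST
  obtain ⟨R', hR', -, hRY⟩ := h.exists_le_conn_sdiff_inter hT hST (h.le_conn_tail_inter hT hST)
  obtain ⟨R'', hR'', -, hRYc⟩ := h.exists_le_conn_sdiff_inter hT hST (h.le_conn_tail_sdiff hT hST)
  obtain ⟨U, hU, hRU, hRU'⟩ := h.isExhaustion.exists_superset hR hR'
  obtain ⟨T₁, hT₁, hUT₁, hRT₁⟩ := h.isExhaustion.exists_superset hU hR''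
  exact ⟨T₁, hT₁, hTR.trans (hRU.trans hUT₁), hRT T₁ hT₁ (hRU.trans hUT₁),
    hRY T₁ hT₁ (hRU'.trans hUT₁), hRYc T₁ hT₁ hRT₁⟩

end CrossesAtEnd

theorem CrossesAtEnd.conn_sdiff_union_le (h : CrossesAtEnd P Q q r 𝒯 S X Y) {s₁ s₂ R : Set E}
    (hs₁ : s₁ ∈ 𝒯) (hs₂ : s₂ ∈ 𝒯) (hs : s₁ ⊆ s₂) (hR : R ∈ 𝒯) (hRB : Rᶜ ⊆ B)
    (hdisj : Disjoint B (s₂ \ s₁)) (hB : M.conn B ≤ m) : M.conn ((s₂ \ s₁) ∪ B) ≤ m := by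
  have conn_sdiff_le := h.isExhaustion.conn_sdiff_le
  obtain ⟨T₀, hT₀, hRT₀, hST₀, hs₂T₀⟩ : ∃ T₀ ∈ 𝒯, R ⊆ T₀ ∧ S ⊆ T₀ ∧ s₂ ⊆ T₀ := by
    obtain ⟨U, hU, hRU, hSU⟩ := h.isExhaustion.exists_superset hR h.mem
    obtain ⟨T₀, hT₀, hUT₀, hs₂T₀⟩ := h.isExhaustion.exists_superset hU hs₂
    exact ⟨T₀, hT₀, hRU.trans hUT₀, hSU.trans hUT₀, hs₂T₀⟩
  obtain ⟨T₁, hT₁, hT₀₁, h₁₀, hT₁Y, hT₁Yc⟩ := h.exists_le_conn_sdiff_and_inter hT₀ hST₀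
  obtain ⟨T₂, hT₂, hT₁₂, h₂₁⟩ := h.exists_le_conn_sdiff hT₁ (hST₀.trans hT₀₁)
  replace h₂₁ := h₂₁ T₂ hT₂ subset_rfl
  have hST₂ : S ⊆ T₂ := hST₀.trans (hT₀₁.trans hT₁₂)
  have hconn {T} (hT : T ∈ 𝒯) (hST : S ⊆ T) : M.conn T = m :=
    (h.isExhaustion.conn_le hT).antisymm (h.le_conn_of_subset hT hST subset_rfl)
  have hskip : M.conn ((T₁ \ T₀) ∪ T₂ᶜ) ≤ m :=
    conn_skip_le (h.separator_subset.trans hST₀) hT₀₁ hT₁₂ h.separates_separator.le_conn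
      (hconn hT₀ hST₀) (hconn hT₂ hST₂) (conn_sdiff_le T₀ hT₀ T₁ hT₁)
      (h.separates_separator_union_tail hT₀ hST₀).le_conn
      (h.separates_separator_union_tail hT₂ hST₂).conn_le
      (h.separates_separator_union_tail_inter hT₀ hST₀).conn_le
      (h.separates_separator_union_tail_inter hT₂ hST₂).le_conn
      (h.le_conn_tail_sdiff hT₂ hST₂) hT₁Y hT₁Yc
  exact conn_opposite_le hs hs₂T₀ hT₀₁ hT₁₂ ((Set.compl_subset_compl.2 hRT₀).trans hRB) hdisj hB
    hskip (hconn hT₂ hST₂).ge h₁₀ h₂₁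
    (conn_sdiff_le s₁ hs₁ T₂ hT₂) (conn_sdiff_le s₂ hs₂ T₁ hT₁)

theorem IsExhaustion.exists_crossesAtEnd (h𝒯 : M.IsExhaustion m 𝒯) (hP : ∀ T ∈ 𝒯, T ∈ P)
    (hQ : ∀ T ∈ 𝒯, T ∈ Q) (hqr : ∃ X ∈ 𝒯, Distinguishes X q r)
    (hPq : ∃ T ∈ 𝒯, Distinguishes T P q) (hPr : ∃ T ∈ 𝒯, Distinguishes T P r)
    (hYPQ : Distinguishes Y P Q) (hYqr : Distinguishes Y q r) :
    ∃ P' Q' q' r' : M.RegularProfile m P₀, ∃ S X Y', CrossesAtEnd P' Q' q' r' 𝒯 S X Y' := by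
  have compl_mem {p : M.RegularProfile m P₀} (hp : ∃ T ∈ 𝒯, Distinguishes T P p) :
      ∃ T ∈ 𝒯, Tᶜ ∈ p := by
    obtain ⟨T, hT, h | h⟩ := hp
    exacts [⟨T, hT, h.2⟩, absurd h.1 (compl_notMem (hP T hT))]
  obtain ⟨S, hS, hSq, hSr⟩ : ∃ S ∈ 𝒯, Sᶜ ∈ q ∧ Sᶜ ∈ r := by
    obtain ⟨T, hT, hTq⟩ := compl_mem hPq
    obtain ⟨T', hT', hTr⟩ := compl_mem hPr
    obtain ⟨S, hS, hTS, hTS'⟩ := h𝒯.exists_superset hT hT'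
    exact ⟨S, hS, compl_mem_of_subset hTq hTS (h𝒯.conn_le hS),
      compl_mem_of_subset hTr hTS' (h𝒯.conn_le hS)⟩
  obtain ⟨X, hX, hXqr⟩ := hqr
  wlog hXqr' : Separates X q r generalizing q r
  · exact this hPr hPq hYqr.symm hSr hSq hXqr.symm
      ((distinguishes_iff.1 hXqr).resolve_left hXqr')
  wlog hYqr' : Separates Y q r generalizing Y
  · exact this hYPQ.compl hYqr.compl
      ((distinguishes_iff.1 hYqr).resolve_left hYqr').compl
  rcases distinguishes_iff.1 hYPQ with hYPQ | hYQP
  · exact ⟨Q, P, q, r, S, X, Y, h𝒯, hQ, hP, hS, hSq, hSr, hX, hXqr', hYqr', hYPQ⟩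
  · exact ⟨P, Q, q, r, S, X, Y, h𝒯, hP, hQ, hS, hSq, hSr, hX, hXqr', hYqr', hYQP⟩

end End

namespace PseudoFlower

section Daisy

variable {E : Type u} {M : ConnectivitySystem E} {k m : ℕ}

theorem index_ofLinearOrder {L : Type u} (r : LinearOrder L) {g : E → L}
    (hg : Function.Surjective g) (h : ∀ J : Set L, J.OrdConnected → M.conn (g ⁻¹' J) < k) :
    (ofLinearOrder r g hg h).index = g :=
  funext fun _ => (mem_petal_iff _).1 rfl

theorem IsDaisy.conn_preimage_eq_iff {Δ : M.PseudoFlower (m + 1)} (hΔ : Δ.IsDaisy)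
    {r : LinearOrder Δ.Index} (hr : IsCutOpen r) {L : Type u} [s : LinearOrder L] [hL : Finite L]
    {c : Δ.Index → L} (hc : Monotone c) (hsurj : Function.Surjective c) {J : Set L}
    (hne : J.Nonempty) (hne_univ : J ≠ Set.univ) :
    M.conn ((c ∘ Δ.index) ⁻¹' J) = m ↔ J.OrdConnected ∨ Jᶜ.OrdConnected := by
  let := LinearOrder.toCircularOrder L
  have hs : IsCutOpen s := isCutOpen_toCircularOrder s
  have hconn (K : Set L) (hK : K.OrdConnected) : M.conn ((c ∘ Δ.index) ⁻¹' K) < (m + 1 : ℕ) := by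
    rw [Set.preimage_comp, ← unionOf_eq_preimage]
    exact Δ.conn_lt _ (hr.isCyclicInterval_of_ordConnected (hK.preimage_mono hc))
  have hsurj' := hsurj.comp Δ.index_surjective
  have hindex := index_ofLinearOrder s hsurj' hconn
  have hle : ofLinearOrder s _ hsurj' hconn ≤ Δ :=
    le_of_monotone (r := s) hs hr hc fun e => congrFun hindex.symm e
  have hunion : (ofLinearOrder s _ hsurj' hconn).unionOf J = (c ∘ Δ.index) ⁻¹' J :=
    (unionOf_eq_preimage (ofLinearOrder s _ hsurj' hconn) J).trans (congrArg (· ⁻¹' J) hindex)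
  rw [← conn_add_one_eq_iff, ← hunion]
  exact (hΔ.2 _ hle hL J hne hne_univ).trans hs.isCyclicInterval_iff

theorem IsDaisy.exists_four_arcs {Δ : M.PseudoFlower (m + 1)} (hΔ : Δ.IsDaisy) :
    ∃ h : E → Fin 4, (∀ a, Δ.IsIntervalUnion (h ⁻¹' {a})) ∧
      ∀ a, m < M.conn (h ⁻¹' {a + 2} ∪ h ⁻¹' {a}) := by
  obtain ⟨r, hr⟩ := exists_isCutOpen Δ.Index
  obtain ⟨c, hc, hsurj⟩ := exists_monotone_surjective_fin hΔ.1.1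
  refine ⟨c ∘ Δ.index, fun a => ⟨c ⁻¹' {a}, ?_, Δ.unionOf_eq_preimage _⟩, fun a => ?_⟩
  · exact hr.isCyclicInterval_of_ordConnected (Set.ordConnected_singleton.preimage_mono hc)
  have hconn (J : Set (Fin 4)) (hne : J.Nonempty) (hne_univ : Jᶜ.Nonempty) :
      M.conn ((c ∘ Δ.index) ⁻¹' J) = m ↔ J.OrdConnected ∨ Jᶜ.OrdConnected := by
    have hup (K : Set (Fin 4)) : K.OrdConnected ↔ (ULift.down.{u} ⁻¹' K).OrdConnected :=
      ⟨fun h => h.preimage_mono fun _ _ => id,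
        fun h => h.preimage_mono (f := ULift.up) fun _ _ => id⟩
    rw [hup, hup, Set.preimage_compl]
    exact hΔ.conn_preimage_eq_iff hr (c := ULift.up ∘ c) (fun _ _ h => hc h)
      (ULift.up_surjective.comp hsurj) (hne.preimage ULift.down_surjective)
      (Set.nonempty_compl.1 (hne_univ.preimage ULift.down_surjective))
  have harc (J : Set (Fin 4)) (hJ : J = {a} ∨ J = {a, a + 1} ∨ J = {a, a + 1, a + 2}) :
      M.conn ((c ∘ Δ.index) ⁻¹' J) = m :=
    (hconn J ⟨a, by grind⟩ ⟨a + 3, by grind⟩).2 (ordConnected_or_of_fin_four hJ)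
  rw [← Set.preimage_union, Set.singleton_union]
  refine lt_of_le_of_ne' (le_conn_of_union_of_inter (harc {a, a + 1} (by tauto)).le
    (harc {a} (by tauto)).ge (harc {a, a + 1, a + 2} (by tauto)).ge ?_ ?_) ?_
  · rw [← Set.preimage_union]
    exact congrArg _ (by clear * -; grind)
  · rw [← Set.preimage_inter]
    exact congrArg _ (by clear * -; grind)
  · exact fun h => not_ordConnected_or_of_fin_four a
      ((hconn _ ⟨a, by grind⟩ ⟨a + 1, by grind⟩).1 h)

end Daisy

section OppositeArcs

variable {E : Type u} {M : ConnectivitySystem E} {m : ℕ} {P₀ : Set (Set E)}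
  {Φ : M.PseudoFlower (m + 1)} {𝒞 : Set (Set E)}

theorem IsLinearization.compl_subset_or_eq_sdiff (h𝒞 : Φ.IsLinearization 𝒞)
    (hempty : (∅ : Set E) ≠ Set.univ) {A : Set E} (hA : Φ.IsIntervalUnion A) :
    (∃ R ∈ 𝒞 \ {Set.univ}, Rᶜ ⊆ A) ∨
      ∃ S ∈ 𝒞 \ {Set.univ}, ∃ T ∈ 𝒞 \ {Set.univ}, S ⊆ T ∧ A = T \ S := by
  have hempty_mem : ∅ ∈ 𝒞 \ {Set.univ} := ⟨h𝒞.empty_mem, hempty⟩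
  obtain ⟨S, hS, T, hT, hST, hA⟩ := (h𝒞.isIntervalUnion_iff A).1 hA
  by_cases hS_univ : S = Set.univ
  · rcases hA with rfl | rfl
    · exact Or.inr ⟨∅, hempty_mem, ∅, hempty_mem, subset_rfl, by grind⟩
    · exact Or.inl ⟨∅, hempty_mem, by grind⟩
  by_cases hT_univ : T = Set.univ
  · rcases hA with rfl | rfl
    · exact Or.inl ⟨S, ⟨hS, hS_univ⟩, by grind⟩
    · exact Or.inr ⟨∅, hempty_mem, S, ⟨hS, hS_univ⟩, S.empty_subset, by grind⟩
  · rcases hA with rfl | rfl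
    · exact Or.inr ⟨S, ⟨hS, hS_univ⟩, T, ⟨hT, hT_univ⟩, hST, rfl⟩
    · exact Or.inl ⟨T, ⟨hT, hT_univ⟩, by grind⟩

theorem IsLinearization.exists_opposite_arcs (h𝒞 : Φ.IsLinearization 𝒞)
    (h𝒯 : M.IsExhaustion m (𝒞 \ {Set.univ})) {g : E → Fin 4}
    (hg : ∀ a, Φ.IsIntervalUnion (g ⁻¹' {a})) :
    ∃ a, (∃ R ∈ 𝒞 \ {Set.univ}, Rᶜ ⊆ g ⁻¹' {a}) ∧
      ∃ S ∈ 𝒞 \ {Set.univ}, ∃ T ∈ 𝒞 \ {Set.univ}, S ⊆ T ∧ g ⁻¹' {a + 2} = T \ S := by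
  have harc (a) := h𝒞.compl_subset_or_eq_sdiff h𝒯.empty_mem.2 (hg a)
  obtain ⟨a, R, hR, hRa⟩ : ∃ a, ∃ R ∈ 𝒞 \ {Set.univ}, Rᶜ ⊆ g ⁻¹' {a} := by
    by_contra! htail
    have hbdd (a) : ∃ T ∈ 𝒞 \ {Set.univ}, g ⁻¹' {a} ⊆ T := by
      obtain ⟨R, hR, hRa⟩ | ⟨S, -, T, hT, -, hga⟩ := harc a
      exacts [absurd hRa (htail a R hR), ⟨T, hT, hga ▸ Set.sdiff_subset⟩]
    choose T hT hgT using hbdd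
    have : Nonempty ↥(𝒞 \ {Set.univ}) := ⟨∅, h𝒯.empty_mem⟩
    obtain ⟨V, hV⟩ := h𝒯.isChain.directedOn.directed_val.finite_le fun a => ⟨T a, hT a⟩
    exact V.2.2 (Set.eq_univ_of_forall fun x => hV (g x) (hgT (g x) rfl))
  refine ⟨a, ⟨R, hR, hRa⟩, (harc (a + 2)).resolve_left ?_⟩
  rintro ⟨R', hR', hRa'⟩
  obtain ⟨V, hV, hRV, hRV'⟩ := h𝒯.exists_superset hR hR'
  obtain ⟨x, hx⟩ := (Set.ne_univ_iff_exists_notMem V).1 hV.2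
  have hgx : g x = a := hRa fun h => hx (hRV h)
  have hgx' : g x = a + 2 := hRa' fun h => hx (hRV' h)
  grind

variable {P Q q r : M.RegularProfile m P₀} {Y : Set E}

open RegularProfile

theorem IsDaisy.intervalDistinguishes {Δ : M.PseudoFlower (m + 1)} (hΔ : Δ.IsDaisy)
    (hle : Δ ≤ Φ) (hpetal : ∀ i, Φ.petal i ∈ P) (hPq : Φ.IntervalDistinguishes P q)
    (hPr : Φ.IntervalDistinguishes P r) (hqr : Φ.IntervalDistinguishes q r)
    (hYPQ : Distinguishes Y P Q) (hYqr : Distinguishes Y q r) :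
    Φ.IntervalDistinguishes P Q := by
  by_contra hPQ
  obtain ⟨𝒞, h𝒞, h𝒯, hP⟩ := exists_isExhaustion hpetal
  have hQ (T) (hT : T ∈ 𝒞 \ {Set.univ}) : T ∈ Q := by
    by_contra hTQ
    exact hPQ (intervalDistinguishes_iff.2 ⟨T, h𝒞.isIntervalUnion_mem hT.1,
      Or.inl ⟨hP T hT.1 hT.2, compl_mem_of_notMem hTQ (h𝒯.conn_le hT)⟩⟩)
  have exists_distinguishes {p p' : M.RegularProfile m P₀} (h : Φ.IntervalDistinguishes p p') :
      ∃ T ∈ 𝒞 \ {Set.univ}, Distinguishes T p p' := by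
    obtain ⟨T, hT, hdist⟩ := h𝒞.exists_distinguishes h
    refine ⟨T, ⟨hT, ?_⟩, hdist⟩
    rintro rfl
    exact hdist.elim (fun h => p.univ_notMem h.1) fun h => p'.univ_notMem h.2
  obtain ⟨P', Q', q', r', S, X, Y', hcross⟩ := h𝒯.exists_crossesAtEnd (fun T hT => hP T hT.1 hT.2)
    hQ (exists_distinguishes hqr) (exists_distinguishes hPq) (exists_distinguishes hPr) hYPQ hYqr
  obtain ⟨g, hg, hlt⟩ := hΔ.exists_four_arcs
  obtain ⟨a, ⟨R, hR, hRa⟩, s₁, hs₁, s₂, hs₂, hs, hgs⟩ :=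
    h𝒞.exists_opposite_arcs h𝒯 fun a => (hg a).of_le hle
  have hdisj : Disjoint (g ⁻¹' {a}) (s₂ \ s₁) :=
    hgs ▸ (Set.disjoint_singleton.2 (by grind)).preimage g
  exact (hlt a).not_ge
    (hgs ▸ hcross.conn_sdiff_union_le hs₁ hs₂ hs hR hRa hdisj (hg a).conn_le)

end OppositeArcs

/-! ### Profiles in a petal -/

section Refinement

variable {E : Type u} {M : ConnectivitySystem E} {k : ℕ} {Φ : M.PseudoFlower k} {D : Set E}
  {i₀ : Φ.Index}

open Classical in
/-- The index function that results from splitting off `D` from its petal and placing it before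
all other petals. -/
noncomputable def splitIndex (Φ : M.PseudoFlower k) (D : Set E) (e : E) : WithBot Φ.Index :=
  if e ∈ D then ⊥ else Φ.index e

theorem splitIndex_surjective (hD : D.Nonempty) (hDi₀ : D ⊂ Φ.petal i₀) :
    Function.Surjective (Φ.splitIndex D) := by
  intro i
  induction i with
  | bot => exact hD.imp fun e he => if_pos he
  | coe i =>
    obtain ⟨e, he, heD⟩ : ∃ e ∈ Φ.petal i, e ∉ D := by
      by_cases hi : i = i₀
      · exact hi ▸ Set.exists_of_ssubset hDi₀
      · obtain ⟨e, he⟩ := Φ.petal_nonempty i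
        exact ⟨e, he, fun heD =>
          Set.disjoint_left.1 (Φ.petal_disjoint i i₀ hi) he (hDi₀.subset heD)⟩
    exact ⟨e, (if_neg heD).trans (congrArg _ (Φ.mem_petal_iff.1 he))⟩

theorem conn_splitIndex_preimage_lt {r : LinearOrder Φ.Index} (hr : IsCutOpen r)
    (hi₀ : ∀ i, i₀ ≤ i) (hDi₀ : D ⊆ Φ.petal i₀)
    (hconn : ∀ J, IsLowerSet J → i₀ ∈ J → M.conn (Φ.index ⁻¹' J \ D) < k)
    {K : Set (WithBot Φ.Index)} (hK : K.OrdConnected) :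
    M.conn (Φ.splitIndex D ⁻¹' K) < k := by
  set J : Set Φ.Index := (↑) ⁻¹' K with hJ
  have hD (e) (he : e ∈ D) : Φ.index e = i₀ := Φ.mem_petal_iff.1 (hDi₀ he)
  have hmem (e) : e ∈ Φ.splitIndex D ⁻¹' K ↔ e ∈ D ∧ ⊥ ∈ K ∨ e ∉ D ∧ Φ.index e ∈ J := by
    by_cases he : e ∈ D <;>
      simp only [splitIndex, Set.mem_preimage, hJ, he, if_true, if_false] <;> tauto
  have hJ_conn : J.OrdConnected := hK.preimage_mono WithBot.coe_mono
  have hJ_lt : M.conn (Φ.index ⁻¹' J) < k := by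
    rw [← unionOf_eq_preimage]
    exact Φ.conn_lt J (hr.isCyclicInterval_of_ordConnected hJ_conn)
  by_cases hbot : ⊥ ∈ K <;> by_cases hi₀J : i₀ ∈ J
  · convert hJ_lt using 2
    ext e
    grind
  · have hempty : J = ∅ := Set.eq_empty_of_forall_notMem fun i hi =>
      hi₀J (hK.out hbot hi ⟨bot_le, WithBot.coe_le_coe.2 (hi₀ i)⟩)
    have huniv := hconn Set.univ isLowerSet_univ trivial
    rw [Set.preimage_univ, ← Set.compl_eq_univ_sdiff, M.conn_compl] at huniv
    convert huniv using 2
    ext e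
    grind
  · have hlower : IsLowerSet J := fun i j hji hi => hJ_conn.out hi₀J hi ⟨hi₀ j, hji⟩
    convert hconn J hlower hi₀J using 2
    ext e
    grind
  · convert hJ_lt using 2
    ext e
    grind

theorem not_isMax_of_ssubset_petal {r : LinearOrder Φ.Index} (hr : IsCutOpen r)
    (hi₀ : ∀ i, i₀ ≤ i) (hD : D.Nonempty) (hDi₀ : D ⊂ Φ.petal i₀)
    (hconn : ∀ J, IsLowerSet J → i₀ ∈ J → M.conn (Φ.index ⁻¹' J \ D) < k) : ¬IsMax Φ := by
  intro hmax
  let Ψ := ofLinearOrder WithBot.linearOrder (Φ.splitIndex D) (splitIndex_surjective hD hDi₀)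
    fun _ => conn_splitIndex_preimage_lt hr hi₀ hDi₀.subset hconn
  have hΦΨ : Φ ≤ Ψ := by
    have hmono : Monotone (WithBot.unbotD i₀) := by
      intro i j hij
      induction i with
      | bot => exact hi₀ _
      | coe i =>
        induction j with
        | bot => exact absurd hij (WithBot.not_coe_le_bot i)
        | coe j => exact WithBot.coe_le_coe.1 hij
    refine le_of_monotone hr (isCutOpen_toCircularOrder _) hmono fun e => ?_
    rw [index_ofLinearOrder, splitIndex]
    split_ifs with he
    exacts [(Φ.mem_petal_iff.1 (hDi₀.subset he)).symm, rfl]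
  obtain ⟨J, -, hJ⟩ := (Ψ.isIntervalUnion_petal (⊥ : WithBot Φ.Index)).of_le (hmax hΦΨ)
  have hbot : Φ.splitIndex D ⁻¹' {⊥} = D := by
    ext e
    by_cases he : e ∈ D <;> simp [splitIndex, he]
  have hJD : Φ.index ⁻¹' J = D := (Φ.unionOf_eq_preimage J).symm.trans (hJ.trans hbot)
  obtain ⟨x, hx⟩ := hD
  obtain ⟨y, hy, hyD⟩ := Set.exists_of_ssubset hDi₀
  have hxy : Φ.index x = Φ.index y :=
    (Φ.mem_petal_iff.1 (hDi₀.subset hx)).trans (Φ.mem_petal_iff.1 hy).symm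
  rw [← hJD, Set.mem_preimage] at hx hyD
  exact hyD (hxy ▸ hx)

end Refinement

end PseudoFlower

section PetalRefinement

variable {E : Type u} {M : ConnectivitySystem E} {m : ℕ} {P₀ : Set (Set E)}
  {P Q q r : M.RegularProfile m P₀} {B T Y : Set E}

open RegularProfile

namespace RegularProfile

theorem Separates.exists_conn_sdiff_le (hBP : Bᶜ ∈ P) (hBQ : Bᶜ ∈ Q) (hBq : B ∈ q)
    (hBT : B ⊆ T) (hTB : M.conn (T \ B) ≤ m) (hT : Separates T q r) (hY : Separates Y q r)
    (hYQP : Separates Y Q P) :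
    ∃ D : Set E, D.Nonempty ∧ D ⊂ B ∧ ∀ S : Set E, B ⊆ S → S ⊆ T ∨ T ⊆ S → M.conn S ≤ m →
      M.conn (S \ B) ≤ m → M.conn (S \ D) ≤ m := by
  have hX : Separates (T \ B) q r :=
    ⟨compl_inter_mem hT.1 (compl_compl B |>.symm ▸ hBq) hTB,
      mem_of_subset hT.2 Set.sdiff_subset hTB⟩
  have hXY : Separates (T \ B ∪ Y) q r := hX.union hY
  have hXYP : T \ B ∪ Y ∈ P :=
    union_mem (mem_of_disjoint hBP Set.disjoint_sdiff_right hTB) hYQP.2 hXY.conn_le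
  have hXYQr : Separates (T \ B ∪ Y) Q r :=
    ⟨compl_mem_of_subset hYQP.1 Set.subset_union_right hXY.conn_le, hXY.2⟩
  have hTQr : Separates T Q r := ⟨compl_mem_of_subset hBQ hBT hT.conn_le, hT.2⟩
  have hZ : Separates (T \ (B \ Y)) Q r := by
    have hinter : T \ (B \ Y) = T ∩ (T \ B ∪ Y) := by grind
    exact hinter ▸ hTQr.inter hXYQr
  have hZP : T \ (B \ Y) ∈ P := mem_of_subset hXYP (by grind) hZ.conn_le
  refine ⟨B \ Y, Set.nonempty_iff_ne_empty.2 fun hempty => ?_,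
    Set.sdiff_subset.ssubset_of_ne fun heq => ?_, fun S hBS hST hS hSB => ?_⟩
  · rw [hempty, Set.sdiff_empty] at hZP
    exact compl_notMem hZP (compl_mem_of_subset hBP hBT hT.conn_le)
  · rw [heq] at hZ
    exact compl_notMem (mem_of_disjoint hBQ Set.disjoint_sdiff_right hTB) hZ.1
  · rcases hST with hST | hTS
    · exact conn_inter_le hS hZ.conn_le hT.le_conn (by grind) (by grind)
    · exact conn_union_le hSB hZ.conn_le hX.le_conn (by grind) (by grind)

theorem exists_conn_sdiff_le (hBP : Bᶜ ∈ P) (hBQ : Bᶜ ∈ Q) (hBq : B ∈ q) (hBr : B ∈ r)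
    (hBT : B ⊆ T) (hTB : M.conn (T \ B) ≤ m) (hT : Distinguishes T q r)
    (hYPQ : Distinguishes Y P Q) (hYqr : Distinguishes Y q r) :
    ∃ D : Set E, D.Nonempty ∧ D ⊂ B ∧ ∀ S : Set E, B ⊆ S → S ⊆ T ∨ T ⊆ S → M.conn S ≤ m →
      M.conn (S \ B) ≤ m → M.conn (S \ D) ≤ m := by
  wlog hTqr : Separates T q r generalizing q r
  · exact this hBr hBq hT.symm hYqr.symm ((distinguishes_iff.1 hT).resolve_left hTqr)
  wlog hY : Separates Y q r generalizing Y
  · refine this hYPQ.compl hYqr.compl ?_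
    exact ((distinguishes_iff.1 hYqr).resolve_left hY).compl
  wlog hYQP : Separates Y Q P generalizing P Q
  · exact this hBQ hBP hYPQ.symm ((distinguishes_iff.1 hYPQ).resolve_right hYQP)
  exact hTqr.exists_conn_sdiff_le hBP hBQ hBq hBT hTB hY hYQP

end RegularProfile

namespace PseudoFlower

variable {Φ : M.PseudoFlower (m + 1)} {i₀ : Φ.Index}

theorem IsIntervalUnion.petal_subset_or_disjoint {A : Set E} (hA : Φ.IsIntervalUnion A)
    (i : Φ.Index) : Φ.petal i ⊆ A ∨ Disjoint (Φ.petal i) A := by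
  obtain ⟨J, -, rfl⟩ := hA
  rw [unionOf_eq_preimage, petal_eq_preimage]
  by_cases hi : i ∈ J
  · exact Or.inl (Set.preimage_mono (Set.singleton_subset_iff.2 hi))
  · exact Or.inr ((Set.disjoint_singleton_left.2 hi).preimage _)

theorem IntervalDistinguishes.petal_mem (h : Φ.IntervalDistinguishes P Q)
    (hP : Φ.petal i₀ ∉ P) : Φ.petal i₀ ∈ Q := by
  by_contra hQ
  have hconn := (Φ.isIntervalUnion_petal i₀).conn_le
  have hP' := compl_mem_of_notMem hP hconn
  have hQ' := compl_mem_of_notMem hQ hconn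
  obtain ⟨A, hA, hdist⟩ := intervalDistinguishes_iff.1 h
  refine (distinguishes_iff_mem hA.conn_le).1 hdist ?_
  rcases hA.petal_subset_or_disjoint i₀ with hsub | hdisj
  · have hmem (R : M.RegularProfile m P₀) (hR : (Φ.petal i₀)ᶜ ∈ R) : A ∉ R := fun hAR =>
      compl_notMem hAR (compl_mem_of_subset hR hsub hA.conn_le)
    exact iff_of_false (hmem P hP') (hmem Q hQ')
  · exact iff_of_true (mem_of_disjoint hP' hdisj hA.conn_le) (mem_of_disjoint hQ' hdisj hA.conn_le)

theorem intervalDistinguishes_of_petal_notMem (hmax : IsMax Φ) (hP : Φ.petal i₀ ∉ P)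
    (hPq : Φ.IntervalDistinguishes P q) (hPr : Φ.IntervalDistinguishes P r)
    (hqr : Φ.IntervalDistinguishes q r) (hYPQ : Distinguishes Y P Q)
    (hYqr : Distinguishes Y q r) : Φ.IntervalDistinguishes P Q := by
  by_contra hPQ
  have hconn := (Φ.isIntervalUnion_petal i₀).conn_le
  have hQ : Φ.petal i₀ ∉ Q := fun hQ => hPQ <| intervalDistinguishes_iff.2
    ⟨_, Φ.isIntervalUnion_petal i₀, Or.inr ⟨compl_mem_of_notMem hP hconn, hQ⟩⟩
  obtain ⟨s, hs, hi₀⟩ := exists_isCutOpen_le i₀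
  have h𝒞 := Φ.isLinearization_initialUnions hs
  obtain ⟨-, ⟨K, hK, rfl⟩, hT⟩ := h𝒞.exists_distinguishes hqr
  have hsdiff {J : Set Φ.Index} (hJ : IsLowerSet J) :
      M.conn (Φ.index ⁻¹' J \ Φ.petal i₀) ≤ m := by
    have hpetal : Φ.petal i₀ ∈ Φ.initialUnions s :=
      ⟨Set.Iic i₀, isLowerSet_Iic i₀, by
        rw [petal_eq_preimage, (IsBot.isMin hi₀).Iic_eq]⟩
    exact (h𝒞.isIntervalUnion_sdiff hpetal ⟨J, hJ, rfl⟩).conn_le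
  have hpetal_subset {J : Set Φ.Index} (hJ : i₀ ∈ J) : Φ.petal i₀ ⊆ Φ.index ⁻¹' J :=
    Φ.petal_eq_preimage i₀ ▸ Set.preimage_mono (Set.singleton_subset_iff.2 hJ)
  have hi₀K : i₀ ∈ K := by
    by_contra hi₀K
    obtain rfl : K = ∅ := Set.eq_empty_of_forall_notMem fun i hi => hi₀K (hK (hi₀ i) hi)
    rw [Set.preimage_empty, Distinguishes, Set.compl_empty] at hT
    exact hT.elim (fun h => r.univ_notMem h.2) fun h => q.univ_notMem h.1
  obtain ⟨D, hD, hD_petal, hD_conn⟩ := exists_conn_sdiff_le (compl_mem_of_notMem hP hconn)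
    (compl_mem_of_notMem hQ hconn) (hPq.petal_mem hP) (hPr.petal_mem hP) (hpetal_subset hi₀K)
    (hsdiff hK) hT hYPQ hYqr
  refine not_isMax_of_ssubset_petal hs hi₀ hD hD_petal (fun J hJ hi₀J => ?_) hmax
  exact conn_lt_succ_iff.2 (hD_conn _ (hpetal_subset hi₀J)
    ((hJ.total hK).imp (Set.preimage_mono ·) (Set.preimage_mono ·))
    (h𝒞.isIntervalUnion_mem ⟨J, hJ, rfl⟩).conn_le (hsdiff hJ))

end PseudoFlower

end PetalRefinement

end ConnectivitySystem

theorem mainTheorem5 {E : Type*} (M : ConnectivitySystem E) (k : ℕ) (hk : 1 ≤ k)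
    (Pset : Set (Set (Set E))) (P₀ : Set (Set E))
    (hprofile : ∀ P ∈ Pset, M.IsProfile k P)
    (htruncation : ∀ P ∈ Pset, M.truncation (k - 1) P = P₀)
    (Φ : M.PseudoFlower k)
    (hmax : IsMax Φ)
    (hdaisy : ∃ Δ : M.PseudoFlower k, Δ ≤ Φ ∧ Δ.IsDaisy)
    (hthree : Φ.DistinguishesThree Pset) :
    Φ.IsPrecMaximal Pset := by
  obtain ⟨m, rfl⟩ := Nat.exists_eq_add_of_le' hk
  obtain ⟨-, -, -, -, -, -, ⟨A, hA, -⟩, -⟩ := id hthree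
  have exists_regularProfile (P) (hP : P ∈ Pset) :
      ∃ P' : M.RegularProfile m P₀, (P' : Set (Set E)) = P :=
    hA.exists_regularProfile (hprofile P hP) (htruncation P hP)
  intro Ψ hΦΨ P hP Q hQ hPQ
  obtain ⟨q, hq, r, hr, hPq, hPr, hqr⟩ := hthree.exists_pair (hprofile P hP)
  have hqr' := hΦΨ q hq r hr hqr
  obtain ⟨P, rfl⟩ := exists_regularProfile P hP
  obtain ⟨Q, rfl⟩ := exists_regularProfile Q hQ
  obtain ⟨q, rfl⟩ := exists_regularProfile q hq
  obtain ⟨r, rfl⟩ := exists_regularProfile r hr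
  obtain ⟨Y, -, hYPQ, hYqr⟩ :=
    ConnectivitySystem.PseudoFlower.exists_isIntervalUnion_distinguishes hPQ hqr'
  by_cases hpetal : ∀ i, Φ.petal i ∈ P
  · obtain ⟨Δ, hle, hΔ⟩ := hdaisy
    exact hΔ.intervalDistinguishes hle hpetal hPq hPr hqr hYPQ hYqr
  · obtain ⟨i₀, hi₀⟩ := not_forall.1 hpetal
    exact ConnectivitySystem.PseudoFlower.intervalDistinguishes_of_petal_notMem hmax hi₀ hPq hPr hqr
      hYPQ hYqr
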